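/- Let $X$ be a simplicial complex. A loop in $X$ is a subcomplex $\gamma\subseteq X$ isomorphic to a triangulation of the circle $S^1$. A filling diagram for $\gamma$ is a pair $(D,f)$ where $D$ is a (finite) triangulated $2$-disc and $f:D\to X$ is a simplicial map that maps the boundary $\partial D$ isomorphically onto $\gamma$; it is minimal if the number of triangles of $D$ is the least possible among all filling diagrams for $\gamma$. For $t\ge 4$, the complex $X$ is called $t$-uniform if it is flag and simply connected and, for every loop $\gamma$ in $X$ and every minimal filling diagram $(D,f)$ for $\gamma$, every interior vertex of $D$ has exactly $t$ neighbours in $D$. For a vertex $v$ of $D$ and an integer $n\ge 0$, the sphere $S_n^t$ of radius $n$ centred at $v$ is the set of edges of $D$ both of whose endpoints are at distance $n$ from $v$ in the $1$-skeleton of $D$, and its length $|S_n^t|$ is the number of these edges. The Lucas sequence of the first kind is defined by $U_0(P,Q)=0$, $U_1(P,Q)=1$ and $U_n(P,Q)=P\,U_{n-1}(P,Q)-Q\,U_{n-2}(P,Q)$ for $n\ge 2$. Theorem. Let $t\ge 6$ and let $X$ be a $t$-uniform simplicial complex. Let $\gamma$ be a loop in $X$, let $(D,f)$ be a minimal filling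 diagram for $\gamma$, and let $v$ be an interior vertex of $D$. Let $n\ge 0$ be such that every vertex of $D$ at distance less than $n$ from $v$ is an interior vertex of $D$ (the sphere of radius $n$ may touch $\partial D$). Then $$|S_n^t| = t\cdot U_n(t-4,1).$$ -/

import Mathlib

/-!
Simplicial complexes are Mathlib's `AbstractSimplicialComplex V` (every `v : V` is a vertex);
subcomplexes, which need not use all vertices, are `PreAbstractSimplicialComplex V`.
-/

namespace PreAbstractSimplicialComplex

open Classical in
/-- `K` is a triangulated circle: its vertices can be listed without repetition as
`c 0, …, c (k - 1)`, `k ≥ 3`, in such a way that its simplices are exactly the vertices `c i` and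
the edges `{c i, c (i + 1)}`, with indices modulo `k`. -/
def IsCircle {V : Type*} (K : PreAbstractSimplicialComplex V) : Prop :=
  ∃ (k : ℕ) (c : ZMod k → V), 3 ≤ k ∧ Function.Injective c ∧
    K.faces = {s | ∃ i : ZMod k, s = {c i} ∨ s = {c i, c (i + 1)}}

open Classical in
/-- `K` is a triangulated closed interval: a simple path `c 0, …, c k` with `k ≥ 1` edges. -/
def IsArc {V : Type*} (K : PreAbstractSimplicialComplex V) : Prop :=
  ∃ (k : ℕ) (c : ℕ → V), 1 ≤ k ∧ Set.InjOn c (Set.Iic k) ∧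
    K.faces = {s | (∃ i ≤ k, s = {c i}) ∨ ∃ i < k, s = {c i, c (i + 1)}}

end PreAbstractSimplicialComplex

namespace AbstractSimplicialComplex

/-- The number of `d`-dimensional simplices (meaningful when there are finitely many). -/
noncomputable def numFaces {V : Type*} (K : AbstractSimplicialComplex V) (d : ℕ) : ℕ :=
  {s ∈ K.faces | s.card = d + 1}.ncard

open Classical in
/-- The `1`-skeleton, as a graph. Its graph distance is the metric on the vertices. -/
def skeleton {V : Type*} (K : AbstractSimplicialComplex V) : SimpleGraph V where
  Adj u w := u ≠ w ∧ ({u, w} : Finset V) ∈ K.faces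
  symm := ⟨fun u w h => ⟨h.1.symm, by rw [Finset.pair_comm]; exact h.2⟩⟩
  loopless := ⟨fun _ h => h.1 rfl⟩

open Classical in
/-- The link of a vertex: all simplices that do not contain `v` and span a simplex with `v`. -/
def link {V : Type*} (K : AbstractSimplicialComplex V) (v : V) :
    PreAbstractSimplicialComplex V where
  faces := {s | s.Nonempty ∧ v ∉ s ∧ insert v s ∈ K.faces}
  isRelLowerSet_faces := by
    rintro s ⟨hs, hv, hvs⟩
    refine ⟨hs, fun r hr hne => ⟨hne, fun h => hv (hr h), ?_⟩⟩
    exact (K.isRelLowerSet_faces hvs).2 (Finset.insert_subset_insert v hr)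
      (Finset.insert_nonempty v r)

/-- A flag complex: every nonempty finite set of vertices that are pairwise joined by edges spans
a simplex. -/
def IsFlag {V : Type*} (K : AbstractSimplicialComplex V) : Prop :=
  ∀ s : Finset V, s.Nonempty →
    (∀ u ∈ s, ∀ w ∈ s, u ≠ w → K.skeleton.Adj u w) → s ∈ K.faces

/-- The points of the geometric realization, in barycentric coordinates. -/
def Realization {V : Type*} (K : AbstractSimplicialComplex V) : Type _ :=
  {x : V →₀ ℝ // x.support ∈ K.faces ∧ (∀ v, 0 ≤ x v) ∧ (x.sum fun _ a => a) = 1}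

/-- The weak topology on the geometric realization: a set is open if and only if its intersection
with every closed simplex is open in that simplex, where a closed simplex carries its usual
(coordinatewise) topology. -/
instance {V : Type*} (K : AbstractSimplicialComplex V) : TopologicalSpace K.Realization :=
  ⨆ s : K.faces, TopologicalSpace.coinduced
    (fun x : {x : K.Realization // x.1.support ⊆ s.1} => x.1)
    (TopologicalSpace.induced (fun x v => x.1.1 v) (inferInstance : TopologicalSpace (V → ℝ)))

/-- A triangulated `2`-disc, combinatorially: a finite connected triangulated surface (every vertex
link is a circle or an arc) with nonempty boundary (some vertex link is an arc) and Euler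
characteristic `1`. By the classification of compact surfaces these are exactly the finite
simplicial complexes whose realization is a closed `2`-disc. -/
structure IsDisc {W : Type*} (D : AbstractSimplicialComplex W) : Prop where
  finite : Finite W
  connected : D.skeleton.Connected
  link_circle_or_arc : ∀ w, (D.link w).IsCircle ∨ (D.link w).IsArc
  exists_link_arc : ∃ w, (D.link w).IsArc
  euler_char : (D.numFaces 0 : ℤ) - D.numFaces 1 + D.numFaces 2 = 1

/-- The boundary `∂D` of a triangulated surface: the subcomplex consisting of the edges that lie in
exactly one triangle, and of their vertices. -/
def boundary {W : Type*} (D : AbstractSimplicialComplex W) : PreAbstractSimplicialComplex W where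
  faces := {s | s.Nonempty ∧ ∃ e ∈ D.faces, e.card = 2 ∧ s ⊆ e ∧
    ∃! T : Finset W, T ∈ D.faces ∧ T.card = 3 ∧ e ⊆ T}
  isRelLowerSet_faces := by
    rintro s ⟨hs, e, he, hc, hse, hT⟩
    exact ⟨hs, fun r hr hne => ⟨hne, e, he, hc, hr.trans hse, hT⟩⟩

/-- Interior vertices: the vertices that do not lie on the boundary. -/
def IsInterior {W : Type*} (D : AbstractSimplicialComplex W) (w : W) : Prop :=
  ({w} : Finset W) ∉ D.boundary.faces

/-- A loop (cycle) in `X`: a subcomplex of `X` that is a triangulated circle. -/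
def IsLoop {V : Type*} (X : AbstractSimplicialComplex V)
    (γ : PreAbstractSimplicialComplex V) : Prop :=
  γ ≤ X.toPreAbstractSimplicialComplex ∧ γ.IsCircle

open Classical in
/-- `(D, f)` is a filling diagram for the loop `γ` of `X`: `D` is a triangulated `2`-disc,
`f : D → X` is a simplicial map (possibly degenerate) given by its values on vertices, and `f` maps
`∂D` isomorphically onto `γ`. -/
structure IsFillingDiagram {V W : Type*} (X : AbstractSimplicialComplex V)
    (γ : PreAbstractSimplicialComplex V) (D : AbstractSimplicialComplex W) (f : W → V) : Prop where
  disc : D.IsDisc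
  simplicial : ∀ s ∈ D.faces, s.image f ∈ X.faces
  injOn_boundary : Set.InjOn f {w | ({w} : Finset W) ∈ D.boundary.faces}
  map_boundary : D.boundary.map f = γ

/-- A minimal filling diagram: the area (number of triangles) is the least possible among all
filling diagrams of `γ`. Discs are finite, so vertex types in `Type` give all of them up to
isomorphism. -/
def IsMinimalFillingDiagram {V : Type*} (X : AbstractSimplicialComplex V)
    (γ : PreAbstractSimplicialComplex V) {W : Type} (D : AbstractSimplicialComplex W)
    (f : W → V) : Prop :=
  X.IsFillingDiagram γ D f ∧
    ∀ (W' : Type) (D' : AbstractSimplicialComplex W') (f' : W' → V),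
      X.IsFillingDiagram γ D' f' → D.numFaces 2 ≤ D'.numFaces 2

/-- `t`-uniform complexes, `t ≥ 4`: flag and simply connected, and in every minimal filling diagram
of every loop each interior vertex has exactly `t` neighbours. -/
structure IsUniform {V : Type*} (X : AbstractSimplicialComplex V) (t : ℕ) : Prop where
  four_le : 4 ≤ t
  flag : X.IsFlag
  simplyConnected : SimplyConnectedSpace X.Realization
  card_link : ∀ γ : PreAbstractSimplicialComplex V, X.IsLoop γ →
    ∀ (W : Type) (D : AbstractSimplicialComplex W) (f : W → V),
      X.IsMinimalFillingDiagram γ D f →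
      ∀ w : W, D.IsInterior w → {u | ({u} : Finset W) ∈ (D.link w).faces}.ncard = t

/-- The sphere of radius `n` centred at `v`: the edges spanned by the vertices at distance `n` from
`v` in the `1`-skeleton. -/
def sphere {W : Type*} (D : AbstractSimplicialComplex W) (v : W) (n : ℕ) : Set (Finset W) :=
  {e ∈ D.faces | e.card = 2 ∧ ∀ w ∈ e, D.skeleton.dist v w = n}

end AbstractSimplicialComplex

/-- Lucas sequences of the first kind `U_n(P, Q)`. -/
def lucasU (P Q : ℤ) : ℕ → ℤ
  | 0 => 0
  | 1 => 1
  | n + 2 => P * lucasU P Q (n + 1) - Q * lucasU P Q n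

/-! Sort the vertices by distance from `v`. The heart of the proof is that balls are round: for `1 ≤
k ≤ n` the edges of level `k` form one simple closed curve through all vertices of level `k`,
bounding the triangles that have a vertex of level less than `k` (`isRoundBall`, `levelEdges_succ`).
Granting this, write `s k` for the number of edges of level `k`. A triangle between levels `k` and
`k + 1` has exactly one edge on one of the two spheres, so there are `s k + s (k + 1)` such
triangles; a closed curve has as many vertices as edges; and each vertex of level `k + 1 < n` lies
in `t` triangles. Counting incidences gives `t * s (k + 1) = s (k + 2) + 4 * s (k + 1) + s k`
(`card_levelEdges_add_two`). With `s 0 = 0` and `s 1 = t`, this is `t` times the Lucas recurrence.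

Roundness is proved by induction on the radius, by curvature. In a region bounded by a simple closed
curve, the sum of `6 - deg` over interior vertices and of `3 - (number of triangles)` over boundary
vertices is at least `6` (`gauss_bonnet`). A short path outside a round ball joining two of its
boundary vertices cuts off such a region (`exists_region`). Since `t ≥ 6` and the ball uses at most
three triangles at each of its boundary vertices, only the vertices of the path can contribute
positively, and each contributes at most `2`. A single edge yields at most `4 < 6`, so there are no
chords (`mem_bd_of_isRoundBall`). A path of two edges needs equality, so it bounds a single triangle
(`downLinked_of_isRoundBall`). These two facts determine how the next sphere looks near each vertex
(`card_star_bd_ball`) and show that it is a single curve (`isRoundBall_succ`).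

No planar topology is needed: regions are sets of triangles with mod `2` boundary. The disc enters
through its homology. A set of triangles without boundary is empty, because the surface is connected
and has a boundary; a rank count with the Euler characteristic then makes every cycle a boundary. -/

section Combinatorics

open Finset symmDiff

namespace FaceSet

/-! ### Mod `2` chains of edges and triangles. -/

section

variable {W : Type*} [DecidableEq W]

/-- The members of `S` that contain the vertex `w`. -/
def star (S : Finset (Finset W)) (w : W) : Finset (Finset W) := {T ∈ S | w ∈ T}

/-- The members of `S` that contain the set `e`. -/
def cofaces (S : Finset (Finset W)) (e : Finset W) : Finset (Finset W) := {T ∈ S | e ⊆ T}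

/-- The mod `2` boundary of `S`, among the edges `E`. -/
def bd (E S : Finset (Finset W)) : Finset (Finset W) := {e ∈ E | Odd #(cofaces S e)}

/-- `Y` is a mod `2` cycle of edges from `E`. -/
def IsCycle (E Y : Finset (Finset W)) : Prop := Y ⊆ E ∧ ∀ w, Even #(star Y w)

/-- `Z` is a simple closed curve: a minimal nonempty cycle of maximal degree at most `2`. -/
structure IsCircuit (E Z : Finset (Finset W)) : Prop where
  cycle : IsCycle E Z
  nonempty : Z.Nonempty
  minimal : ∀ Y ⊆ Z, IsCycle E Y → Y = ∅ ∨ Y = Z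
  card_star_le : ∀ w, #(star Z w) ≤ 2

@[simp] lemma mem_star {S : Finset (Finset W)} {w : W} {T : Finset W} :
    T ∈ star S w ↔ T ∈ S ∧ w ∈ T := by simp [star]

@[simp] lemma mem_cofaces {S : Finset (Finset W)} {e T : Finset W} :
    T ∈ cofaces S e ↔ T ∈ S ∧ e ⊆ T := by simp [cofaces]

lemma mem_bd {E S : Finset (Finset W)} {e : Finset W} :
    e ∈ bd E S ↔ e ∈ E ∧ Odd #(cofaces S e) := by simp [bd]

lemma bd_subset (E S : Finset (Finset W)) : bd E S ⊆ E := filter_subset _ _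

lemma exists_mem_of_mem_bd {E S : Finset (Finset W)} {e : Finset W} (h : e ∈ bd E S) :
    ∃ T ∈ S, e ⊆ T := by
  obtain ⟨T, hT⟩ := card_pos.1 (mem_bd.1 h).2.pos
  exact ⟨T, mem_cofaces.1 hT⟩

/-- The sum of the two counts sees the intersection twice, so parities add. This makes the boundary
and the vertex degrees additive mod `2`. -/
lemma odd_card_filter_symmDiff {α : Type*} [DecidableEq α] (A B : Finset α) (p : α → Prop)
    [DecidablePred p] :
    Odd #{x ∈ A ∆ B | p x} ↔ ¬ (Odd #{x ∈ A | p x} ↔ Odd #{x ∈ B | p x}) := by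
  have h : #{x ∈ A ∆ B | p x} + 2 * #{x ∈ A ∩ B | p x} = #{x ∈ A | p x} + #{x ∈ B | p x} := by
    rw [← card_union_add_card_inter, ← filter_union, ← filter_inter_distrib,
      show A ∪ B = A ∆ B ∪ A ∩ B by
        ext x; simp only [mem_union, mem_symmDiff, mem_inter]; tauto, filter_union,
      card_union_of_disjoint]
    · ring
    · rw [disjoint_left]
      intro x hx hx'
      simp only [mem_filter, mem_symmDiff, mem_inter] at hx hx'
      tauto
  have h' : Odd #{x ∈ A ∆ B | p x} ↔ Odd (#{x ∈ A | p x} + #{x ∈ B | p x}) := by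
    rw [← h]; simp [Nat.odd_add]
  rw [h', Nat.odd_add, ← Nat.not_odd_iff_even]
  tauto

lemma bd_symmDiff (E S S' : Finset (Finset W)) : bd E (S ∆ S') = bd E S ∆ bd E S' := by
  ext e
  have := odd_card_filter_symmDiff S S' (fun T => e ⊆ T)
  simp only [mem_symmDiff, mem_bd, cofaces] at *
  tauto

lemma odd_card_star_symmDiff (Y Y' : Finset (Finset W)) (w : W) :
    Odd #(star (Y ∆ Y') w) ↔ ¬ (Odd #(star Y w) ↔ Odd #(star Y' w)) :=
  odd_card_filter_symmDiff Y Y' (fun T => w ∈ T)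

lemma IsCycle.symmDiff {E Y Y' : Finset (Finset W)} (h : IsCycle E Y) (h' : IsCycle E Y') :
    IsCycle E (Y ∆ Y') := by
  refine ⟨fun e he => ?_, fun w => ?_⟩
  · rcases mem_symmDiff.1 he with he | he
    exacts [h.1 he.1, h'.1 he.1]
  · rw [← Nat.not_odd_iff_even, odd_card_star_symmDiff]
    have h1 := h.2 w
    have h2 := h'.2 w
    rw [← Nat.not_odd_iff_even] at h1 h2
    tauto

lemma symmDiff_eq_sdiff {α : Type*} [DecidableEq α] {A B : Finset α} (h : B ⊆ A) :
    A ∆ B = A \ B := by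
  ext x; simp only [mem_symmDiff, mem_sdiff]
  have := @h x
  tauto

lemma symmDiff_eq_union {α : Type*} [DecidableEq α] {A B : Finset α} (h : Disjoint A B) :
    A ∆ B = A ∪ B := by
  ext x; simp only [mem_symmDiff, mem_union]
  have := @disjoint_left _ A B
  have := this.1 h
  have := @this x
  tauto

/-! ### Incidence matrices over the field with two elements, and rank counts. -/

section LinearAlgebra

variable {α β : Type*} [DecidableEq α]

/-- The linear map over the field with two elements given by an incidence relation. -/
def incidence (A : Finset α) (B : Finset β) (r : β → α → Prop) [∀ b a, Decidable (r b a)] :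
    (A → ZMod 2) →ₗ[ZMod 2] (B → ZMod 2) :=
  Matrix.mulVecLin (Matrix.of fun b a => if r b.1 a.1 then 1 else 0)

/-- The indicator function of `S` on `A`. -/
def indic (A S : Finset α) : A → ZMod 2 := fun a => if a.1 ∈ S then 1 else 0

lemma exists_indic_eq {A : Finset α} (f : A → ZMod 2) : ∃ S ⊆ A, indic A S = f := by
  refine ⟨{a ∈ A | ∃ h : a ∈ A, f ⟨a, h⟩ = 1}, filter_subset _ _, ?_⟩
  ext ⟨a, ha⟩
  have h2 : ∀ z : ZMod 2, z = 0 ∨ z = 1 := by decide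
  rcases h2 (f ⟨a, ha⟩) with h | h <;> simp [indic, h, ha]

lemma indic_injective {A S S' : Finset α} (hS : S ⊆ A) (hS' : S' ⊆ A)
    (h : indic A S = indic A S') : S = S' := by
  ext a
  by_cases ha : a ∈ A
  · have := congrFun h ⟨a, ha⟩
    simp only [indic] at this
    by_cases h1 : a ∈ S <;> by_cases h2 : a ∈ S' <;> simp_all
  · exact ⟨fun h => absurd (hS h) ha, fun h => absurd (hS' h) ha⟩

lemma incidence_indic (A : Finset α) (B : Finset β) (r : β → α → Prop)
    [∀ b a, Decidable (r b a)] {S : Finset α} (hS : S ⊆ A) (b : B) :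
    incidence A B r (indic A S) b = (#{a ∈ S | r b.1 a} : ZMod 2) := by
  simp only [incidence, Matrix.mulVecLin_apply, Matrix.mulVec, dotProduct, Matrix.of_apply, indic,
    ← ite_and, mul_ite, mul_one, mul_zero]
  rw [Finset.sum_coe_sort A (fun a => if a ∈ S ∧ r b.1 a then (1 : ZMod 2) else 0), sum_boole]
  congr 2
  ext a
  simp only [mem_filter]
  exact ⟨fun h => h.2, fun h => ⟨hS h.1, h⟩⟩

lemma incidence_indic_eq_zero (A : Finset α) (B : Finset β) (r : β → α → Prop)
    [∀ b a, Decidable (r b a)] {S : Finset α} (hS : S ⊆ A) :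
    incidence A B r (indic A S) = 0 ↔ ∀ b ∈ B, Even #{a ∈ S | r b a} := by
  rw [funext_iff, Subtype.forall]
  refine forall₂_congr fun b hb => ?_
  rw [incidence_indic A B r hS, Pi.zero_apply, ZMod.natCast_eq_zero_iff_even]

lemma incidence_indic_eq_indic [DecidableEq β] (A : Finset α) (B : Finset β) (r : β → α → Prop)
    [∀ b a, Decidable (r b a)] {S : Finset α} (hS : S ⊆ A) (Y : Finset β) :
    incidence A B r (indic A S) = indic B Y ↔ ∀ b ∈ B, (b ∈ Y ↔ Odd #{a ∈ S | r b a}) := by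
  rw [funext_iff, Subtype.forall]
  refine forall₂_congr fun b hb => ?_
  rw [incidence_indic A B r hS, indic]
  by_cases h : b ∈ Y
  · simp only [h, if_true, true_iff]; exact ZMod.natCast_eq_one_iff_odd
  · simp only [h, if_false, false_iff, Nat.not_odd_iff_even]; exact ZMod.natCast_eq_zero_iff_even

end LinearAlgebra

/-- If the cycles of a graph are boundaries of faces, there are enough faces. -/
lemma card_edges_add_one_le {V : Finset W} (hV : V.Nonempty) {E T : Finset (Finset W)}
    (hE : ∀ e ∈ E, #e = 2 ∧ e ⊆ V)
    (h : ∀ Y, IsCycle E Y → ∃ S ⊆ T, bd E S = Y) : #E + 1 ≤ #T + #V := by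
  set d₁ := incidence E V (fun w e => w ∈ e)
  set d₂ := incidence T E (fun e τ => e ⊆ τ)
  have hker : LinearMap.ker d₁ ≤ LinearMap.range d₂ := by
    intro f hf
    obtain ⟨Y, hY, rfl⟩ := exists_indic_eq f
    rw [LinearMap.mem_ker, incidence_indic_eq_zero _ _ _ hY] at hf
    obtain ⟨S, hS, rfl⟩ := h Y ⟨hY, fun w => by
      by_cases hw : w ∈ V
      · exact hf w hw
      · rw [show star Y w = ∅ by
          ext e; simp only [mem_star, notMem_empty, iff_false, not_and]
          exact fun he hwe => hw ((hE e (hY he)).2 hwe)]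
        simp⟩
    refine ⟨indic T S, (incidence_indic_eq_indic _ _ _ hS _).2 fun e he => ?_⟩
    rw [mem_bd]; simp [he, cofaces]
  -- Every edge has two ends, so the image of `d₁` has coordinate sum zero. This lowers its rank by
  -- one and produces the `+ 1`.
  let σ : (V → ZMod 2) →ₗ[ZMod 2] ZMod 2 := ∑ i, LinearMap.proj i
  have hσ : ∀ x, σ x = ∑ i, x i := fun x => by simp [σ]
  have hr : LinearMap.range d₁ ≤ LinearMap.ker σ := by
    rintro _ ⟨f, rfl⟩
    obtain ⟨Y, hY, rfl⟩ := exists_indic_eq f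
    rw [LinearMap.mem_ker, hσ]
    simp only [d₁, incidence_indic _ _ _ hY]
    rw [Finset.sum_coe_sort V (fun w => (#{e ∈ Y | w ∈ e} : ZMod 2)), ← Nat.cast_sum,
      ZMod.natCast_eq_zero_iff_even]
    have hdc := sum_card_bipartiteAbove_eq_sum_card_bipartiteBelow (s := V) (t := Y)
      (fun w e => w ∈ e)
    simp only [bipartiteAbove] at hdc
    rw [hdc]
    refine even_sum _ fun e he => ?_
    rw [bipartiteBelow, filter_mem_eq_inter, inter_eq_right.2 (hE e (hY he)).2, (hE e (hY he)).1]
    exact even_two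
  have hs : Function.Surjective σ := by
    obtain ⟨w, hw⟩ := hV
    intro c
    refine ⟨Pi.single ⟨w, hw⟩ c, ?_⟩
    rw [hσ]; simp
  have e1 := LinearMap.finrank_range_add_finrank_ker d₁
  have e2 := LinearMap.finrank_range_add_finrank_ker σ
  have e3 := LinearMap.finrank_range_le d₂
  have e4 := Submodule.finrank_mono hker
  have e5 := Submodule.finrank_mono hr
  rw [LinearMap.range_eq_top.2 hs, finrank_top] at e2
  simp only [Module.finrank_fintype_fun_eq_card, Fintype.card_coe, Module.finrank_self] at e1 e2 e3
  omega

/-- In a connected complex with injective boundary map and the Euler characteristic of a disc,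
every cycle is a boundary. -/
lemma exists_bd_eq_of_euler [Fintype W] {E F : Finset (Finset W)} (v : W)
    (hconn : ∀ w, Relation.ReflTransGen (fun a b => a ≠ b ∧ {a, b} ∈ E) v w)
    (hcyc : ∀ S ⊆ F, IsCycle E (bd E S)) (hinj : ∀ S ⊆ F, bd E S = ∅ → S = ∅)
    (heuler : #F + Fintype.card W = #E + 1) {Y : Finset (Finset W)} (hY : IsCycle E Y) :
    ∃ S ⊆ F, bd E S = Y := by
  set d₁ := incidence E (univ : Finset W) (fun w e => w ∈ e)
  set d₂ := incidence F E (fun e τ => e ⊆ τ)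
  have hbd : ∀ S ⊆ F, d₂ (indic F S) = indic E (bd E S) := fun S hS =>
    (incidence_indic_eq_indic _ _ _ hS _).2 fun e he => by rw [mem_bd]; simp [he, cofaces]
  have hr : LinearMap.range d₂ ≤ LinearMap.ker d₁ := by
    rintro _ ⟨f, rfl⟩
    obtain ⟨S, hS, rfl⟩ := exists_indic_eq f
    rw [LinearMap.mem_ker, hbd S hS, incidence_indic_eq_zero _ _ _ (bd_subset _ _)]
    exact fun w _ => (hcyc S hS).2 w
  have hd₂ : LinearMap.ker d₂ = ⊥ := by
    rw [LinearMap.ker_eq_bot']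
    intro f hf
    obtain ⟨S, hS, rfl⟩ := exists_indic_eq f
    rw [hbd S hS] at hf
    have : bd E S = ∅ := indic_injective (bd_subset _ _) (empty_subset E) (by
      rw [hf]; ext; simp [indic])
    rw [hinj S hS this]; ext; simp [indic]
  -- Connectedness makes every vertex homologous to `v`, so `d₁` has rank at least the number of
  -- vertices minus one. As `d₂` is injective, the Euler relation leaves no room between its range
  -- and the kernel of `d₁`.
  have htop : ⊤ ≤ LinearMap.range d₁ ⊔
      Submodule.span (ZMod 2) {indic (univ : Finset W) {v}} := by
    have key : ∀ w, indic (univ : Finset W) {w} ∈ LinearMap.range d₁ ⊔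
        Submodule.span (ZMod 2) {indic (univ : Finset W) {v}} := by
      intro w
      induction hconn w with
      | refl => exact Submodule.mem_sup_right (Submodule.mem_span_singleton_self _)
      | @tail a b _ hab ih =>
        have : indic (univ : Finset W) {b} = indic (univ : Finset W) {a} + d₁ (indic E {{a, b}}) := by
          ext ⟨x, hx⟩
          rw [Pi.add_apply, incidence_indic _ _ _ (singleton_subset_iff.2 hab.2)]
          have h1 := hab.1
          by_cases hxa : x = a <;> by_cases hxb : x = b <;>
            simp_all [indic, filter_singleton, CharTwo.add_self_eq_zero]
        rw [this]
        exact Submodule.add_mem _ ih (Submodule.mem_sup_left ⟨_, rfl⟩)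
    intro f _
    have : f = ∑ i, f i • indic (univ : Finset W) {i.1} := by
      ext ⟨x, hx⟩
      rw [Finset.sum_apply, Finset.sum_eq_single ⟨x, hx⟩]
      · simp [indic]
      · rintro ⟨b, hb⟩ _ hbx
        have : x ≠ b := fun h => hbx (by simp [h])
        simp [indic, this]
      · simp
    rw [this]
    exact Submodule.sum_mem _ fun i _ => Submodule.smul_mem _ _ (key i)
  have e1 := LinearMap.finrank_range_add_finrank_ker d₁
  have e2 := LinearMap.finrank_range_add_finrank_ker d₂
  have e3 := Submodule.finrank_mono htop
  have e4 := Submodule.finrank_add_le_finrank_add_finrank (LinearMap.range d₁)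
    (Submodule.span (ZMod 2) {indic (univ : Finset W) {v}})
  have e5 := finrank_span_le_card (R := ZMod 2) {indic (univ : Finset W) {v}}
  rw [Set.toFinset_singleton, card_singleton] at e5
  rw [hd₂, finrank_bot] at e2
  rw [finrank_top] at e3
  simp only [Module.finrank_fintype_fun_eq_card, Fintype.card_coe, card_univ] at e1 e2 e3
  have heq : LinearMap.range d₂ = LinearMap.ker d₁ := 
    Submodule.eq_of_le_of_finrank_le hr (by omega)
  have hYk : indic E Y ∈ LinearMap.ker d₁ := by
    rw [LinearMap.mem_ker, incidence_indic_eq_zero _ _ _ hY.1]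
    exact fun w _ => hY.2 w
  rw [← heq] at hYk
  obtain ⟨f, hf⟩ := hYk
  obtain ⟨S, hS, rfl⟩ := exists_indic_eq f
  rw [hbd S hS] at hf
  exact ⟨S, hS, indic_injective (bd_subset _ _) hY.1 hf⟩

end

/-! ### Triangulated surfaces and the combinatorial Gauss-Bonnet inequality. -/

section

variable {W : Type*} [DecidableEq W]

/-- `E` and `F` are the edges and the triangles of a triangulated surface, possibly with boundary:
every edge lies in one or two triangles, and the triangles at a vertex are connected through the
edges at that vertex. -/
structure IsTriangulatedSurface (E F : Finset (Finset W)) : Prop where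
  card_edge : ∀ e ∈ E, #e = 2
  card_face : ∀ T ∈ F, #T = 3
  edge_mem : ∀ T ∈ F, ∀ e ⊆ T, #e = 2 → e ∈ E
  exists_face : ∀ e ∈ E, ∃ T ∈ F, e ⊆ T
  card_cofaces_le : ∀ e ∈ E, #(cofaces F e) ≤ 2
  star_connected : ∀ w, ∀ S ⊆ F,
    (∀ e ∈ E, w ∈ e → ∀ T ∈ S, ∀ T' ∈ F, e ⊆ T → e ⊆ T' → T' ∈ S) →
    ∀ T ∈ S, w ∈ T → ∀ T' ∈ F, w ∈ T' → T' ∈ S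

/-- No edge at `w` is a boundary edge. -/
def IsInner (E F : Finset (Finset W)) (w : W) : Prop :=
  ∀ e ∈ E, w ∈ e → #(cofaces F e) = 2

namespace IsTriangulatedSurface

variable {E F : Finset (Finset W)} (hs : IsTriangulatedSurface E F)

include hs

lemma exists_eq_pair {e : Finset W} (he : e ∈ E) {w : W} (hw : w ∈ e) :
    ∃ u, u ≠ w ∧ e = {w, u} := by
  obtain ⟨a, b, hab, rfl⟩ := card_eq_two.1 (hs.card_edge e he)
  rcases mem_insert.1 hw with rfl | hw
  · exact ⟨b, hab.symm, rfl⟩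
  · rw [mem_singleton] at hw
    subst hw
    exact ⟨a, hab, pair_comm _ _⟩

lemma pair_mem {T : Finset W} (hT : T ∈ F) {a b : W} (ha : a ∈ T) (hb : b ∈ T) (hab : a ≠ b) :
    {a, b} ∈ E :=
  hs.edge_mem T hT _ (insert_subset ha (singleton_subset_iff.2 hb)) (card_pair hab)

lemma ne_of_pair_mem {a b : W} (h : {a, b} ∈ E) : a ≠ b := by
  rintro rfl
  have := hs.card_edge _ h
  simp at this

lemma eq_of_subset {e : Finset W} (he : e ∈ E) {a b : W} (hab : a ≠ b) (ha : a ∈ e) (hb : b ∈ e) :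
    e = {a, b} :=
  (eq_of_subset_of_card_le (insert_subset ha (singleton_subset_iff.2 hb))
    (by rw [hs.card_edge e he, card_pair hab])).symm

lemma face_eq {T : Finset W} (hT : T ∈ F) {a b c : W} (ha : a ∈ T) (hb : b ∈ T) (hc : c ∈ T)
    (hab : a ≠ b) (hac : a ≠ c) (hbc : b ≠ c) : T = {a, b, c} := by
  refine (eq_of_subset_of_card_le ?_ ?_).symm
  · intro x hx
    simp only [mem_insert, mem_singleton] at hx
    rcases hx with rfl | rfl | rfl <;> assumption
  · rw [hs.card_face T hT, card_eq_three.2 ⟨a, b, c, hab, hac, hbc, rfl⟩]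

lemma eq_or_eq_of_coface {e T₁ T₂ T : Finset W} (he : e ∈ E) (h₁ : T₁ ∈ F) (h₂ : T₂ ∈ F)
    (hT : T ∈ F) (h : T₁ ≠ T₂) (s₁ : e ⊆ T₁) (s₂ : e ⊆ T₂) (s : e ⊆ T) : T = T₁ ∨ T = T₂ := by
  by_contra! hne
  have : #{T, T₁, T₂} ≤ #(cofaces F e) := card_le_card fun x hx => by
    simp only [mem_insert, mem_singleton] at hx
    rw [mem_cofaces]
    rcases hx with rfl | rfl | rfl <;> exact ⟨‹_›, ‹_›⟩
  rw [card_eq_three.2 ⟨T, T₁, T₂, hne.1, hne.2, h, rfl⟩] at this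
  have := hs.card_cofaces_le e he
  omega

lemma card_cofaces_eq_two {S : Finset (Finset W)} (hS : S ⊆ F) {e T₁ T₂ : Finset W}
    (he : e ∈ E) (h₁ : T₁ ∈ S) (h₂ : T₂ ∈ S) (h : T₁ ≠ T₂) (s₁ : e ⊆ T₁) (s₂ : e ⊆ T₂) :
    #(cofaces S e) = 2 := by
  have h1 : 1 < #(cofaces S e) :=
    one_lt_card.2 ⟨T₁, mem_cofaces.2 ⟨h₁, s₁⟩, T₂, mem_cofaces.2 ⟨h₂, s₂⟩, h⟩
  have h2 : #(cofaces S e) ≤ #(cofaces F e) := card_le_card (filter_subset_filter _ hS)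
  have := hs.card_cofaces_le e he
  omega

lemma notMem_bd_of_two {S : Finset (Finset W)} (hS : S ⊆ F) {e T₁ T₂ : Finset W}
    (h₁ : T₁ ∈ S) (h₂ : T₂ ∈ S) (h : T₁ ≠ T₂) (s₁ : e ⊆ T₁) (s₂ : e ⊆ T₂) : e ∉ bd E S := by
  intro he
  rw [mem_bd] at he
  rw [hs.card_cofaces_eq_two hS he.1 h₁ h₂ h s₁ s₂] at he
  exact absurd he.2 (by decide)

lemma mem_bd_of_mem_of_notMem {S : Finset (Finset W)} (hS : S ⊆ F) {e T T' : Finset W}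
    (he : e ∈ E) (hT : T ∈ S) (hT' : T' ∈ F) (hn : T' ∉ S) (s : e ⊆ T) (s' : e ⊆ T') :
    e ∈ bd E S := by
  refine mem_bd.2 ⟨he, ?_⟩
  have : cofaces S e = {T} := by
    ext x
    simp only [mem_cofaces, mem_singleton]
    constructor
    · rintro ⟨hx, hex⟩
      by_contra hne
      rcases hs.eq_or_eq_of_coface he (hS hx) (hS hT) hT' hne hex s s' with rfl | rfl
      exacts [hn hx, hn hT]
    · rintro rfl; exact ⟨hT, s⟩
  rw [this]; simp

/-- A set of triangles whose boundary avoids `w` contains all or none of the triangles at `w`. -/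
lemma star_subset {S : Finset (Finset W)} (hS : S ⊆ F) {w : W} (hw : ∀ e ∈ bd E S, w ∉ e)
    {T : Finset W} (hT : T ∈ S) (hwT : w ∈ T) {T' : Finset W} (hT' : T' ∈ F) (hw' : w ∈ T') :
    T' ∈ S := by
  refine hs.star_connected w S hS ?_ T hT hwT T' hT' hw'
  intro e he hwe T₁ h₁ T₂ h₂ s₁ s₂
  by_contra hn
  exact hw e (hs.mem_bd_of_mem_of_notMem hS he h₁ h₂ hn s₁ s₂) hwe

lemma star_eq {S : Finset (Finset W)} (hS : S ⊆ F) {w : W} (hw : ∀ e ∈ bd E S, w ∉ e)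
    {T : Finset W} (hT : T ∈ S) (hwT : w ∈ T) : star S w = star F w := by
  ext T'
  simp only [mem_star]
  exact ⟨fun h => ⟨hS h.1, h.2⟩, fun h => ⟨hs.star_subset hS hw hT hwT h.1 h.2, h.2⟩⟩

/-- All triangles at `w` belong to `S`, so the number of triangles at an edge through `w` is even,
positive and at most two. -/
lemma isInner_of_star {S : Finset (Finset W)} (hS : S ⊆ F) {w : W} (hw : ∀ e ∈ bd E S, w ∉ e)
    {T : Finset W} (hT : T ∈ S) (hwT : w ∈ T) : IsInner E F w := by
  intro e he hwe
  have h1 : cofaces F e = cofaces S e := by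
    ext x
    simp only [mem_cofaces]
    exact ⟨fun h => ⟨hs.star_subset hS hw hT hwT h.1 (h.2 hwe), h.2⟩, fun h => ⟨hS h.1, h.2⟩⟩
  have h2 : ¬ Odd #(cofaces S e) := fun h => hw e (mem_bd.2 ⟨he, h⟩) hwe
  obtain ⟨T₀, h₀, s₀⟩ := hs.exists_face e he
  have h3 : 0 < #(cofaces F e) := card_pos.2 ⟨T₀, mem_cofaces.2 ⟨h₀, s₀⟩⟩
  have h4 := hs.card_cofaces_le e he
  rw [← h1] at h2
  interval_cases h : #(cofaces F e)
  · exact absurd (by decide) h2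
  · rfl

lemma card_edges_at {T : Finset W} (hT : T ∈ F) {w : W} (hw : w ∈ T) :
    #{e ∈ star E w | e ⊆ T} = 2 := by
  have : {e ∈ star E w | e ⊆ T} = (T.erase w).image (fun u => {w, u}) := by
    ext e
    simp only [mem_filter, mem_star, mem_image, mem_erase]
    constructor
    · rintro ⟨⟨he, hwe⟩, heT⟩
      obtain ⟨u, hu, rfl⟩ := hs.exists_eq_pair he hwe
      exact ⟨u, ⟨hu, heT (by simp)⟩, rfl⟩
    · rintro ⟨u, ⟨hu, huT⟩, rfl⟩
      exact ⟨⟨hs.pair_mem hT hw huT hu.symm, by simp⟩,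
        insert_subset hw (singleton_subset_iff.2 huT)⟩
  rw [this, card_image_of_injOn, card_erase_of_mem hw, hs.card_face T hT]
  intro a ha b hb hab
  have h1 : a ∈ ({w, b} : Finset W) := by
    have : a ∈ ({w, a} : Finset W) := by simp
    rwa [show ({w, a} : Finset W) = {w, b} from hab] at this
  simp only [coe_erase, Set.mem_sdiff, mem_coe, Set.mem_singleton_iff] at ha
  simpa [ha.2] using h1

lemma sum_cofaces_star {S : Finset (Finset W)} (hS : S ⊆ F) (w : W) :
    ∑ e ∈ star E w, #(cofaces S e) = 2 * #(star S w) := by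
  have := sum_card_bipartiteAbove_eq_sum_card_bipartiteBelow (s := star E w) (t := S)
      (fun e T => e ⊆ T)
  simp only [bipartiteAbove, bipartiteBelow] at this
  simp only [cofaces]
  rw [this, ← sum_filter_add_sum_filter_not S (fun T => w ∈ T),
    sum_const_nat (m := 2) (fun T hT => hs.card_edges_at (hS (mem_filter.1 hT).1)
      (mem_filter.1 hT).2), sum_eq_zero (s := {T ∈ S | ¬ w ∈ T}), add_zero, mul_comm, star]
  intro T hT
  rw [card_eq_zero, filter_eq_empty_iff]
  exact fun e he heT => (mem_filter.1 hT).2 (heT (mem_star.1 he).2)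

/-- Each triangle at `w` has two edges at `w`, so the coface numbers of the edges at `w` have an
even sum, and evenly many of them are odd. -/
lemma isCycle_bd {S : Finset (Finset W)} (hS : S ⊆ F) : IsCycle E (bd E S) := by
  refine ⟨bd_subset _ _, fun w => ?_⟩
  have h := odd_sum_iff_odd_card_odd (s := star E w) (fun e => #(cofaces S e))
  rw [hs.sum_cofaces_star hS w] at h
  have h' : star (bd E S) w = {e ∈ star E w | Odd #(cofaces S e)} := by
    ext e; simp only [mem_star, mem_bd, mem_filter]; tauto
  rw [h', ← Nat.not_odd_iff_even, ← h]
  simp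

lemma card_star_of_isInner {w : W} (hw : IsInner E F w) : #(star F w) = #(star E w) := by
  have := hs.sum_cofaces_star (Subset.refl F) w
  rw [sum_const_nat (m := 2)] at this
  · omega
  · exact fun e he => hw e (mem_star.1 he).1 (mem_star.1 he).2

lemma card_edges_of_face {T : Finset W} (hT : T ∈ F) : #{e ∈ E | e ⊆ T} = 3 := by
  have : {e ∈ E | e ⊆ T} = T.powersetCard 2 := by
    ext e
    simp only [mem_filter, mem_powersetCard]
    exact ⟨fun h => ⟨h.2, hs.card_edge e h.1⟩, fun h => ⟨hs.edge_mem T hT e h.1 h.2, h.1⟩⟩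
  rw [this, card_powersetCard, hs.card_face T hT]
  rfl

/-- Combinatorial Gauss-Bonnet inequality for the region inside a simple closed curve. -/
lemma gauss_bonnet (hH : ∀ Y, IsCycle E Y → ∃ S ⊆ F, bd E S = Y)
    (hinj : ∀ S ⊆ F, bd E S = ∅ → S = ∅) {T : Finset (Finset W)} (hT : T ⊆ F)
    (hZ : IsCircuit E (bd E T)) :
    (6 : ℤ) ≤ ∑ w ∈ T.biUnion id,
      ((if (star (bd E T) w).Nonempty then 3 else 6) - (#(star T w) : ℤ)) := by
  set Z := bd E T with hZdef
  set V := T.biUnion id with hV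
  set E' := {e ∈ E | ∃ τ ∈ T, e ⊆ τ} with hE'
  have hZE' : Z ⊆ E' := fun e he =>
    mem_filter.2 ⟨bd_subset _ _ he, exists_mem_of_mem_bd he⟩
  have hTne : T.Nonempty := by
    obtain ⟨e, he⟩ := hZ.nonempty
    obtain ⟨τ, hτ, -⟩ := exists_mem_of_mem_bd he
    exact ⟨τ, hτ⟩
  have hVne : V.Nonempty := by
    obtain ⟨τ, hτ⟩ := hTne
    have : 0 < #τ := by rw [hs.card_face τ (hT hτ)]; norm_num
    obtain ⟨w, hw⟩ := card_pos.1 this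
    exact ⟨w, mem_biUnion.2 ⟨τ, hτ, hw⟩⟩
  have heuler : #E' + 1 ≤ #T + #V := by
    refine card_edges_add_one_le hVne ?_ ?_
    · intro e he
      rw [hE', mem_filter] at he
      obtain ⟨he, τ, hτ, heτ⟩ := he
      exact ⟨hs.card_edge e he, fun x hx => mem_biUnion.2 ⟨τ, hτ, heτ hx⟩⟩
    · intro Y hY
      obtain ⟨S, hS, hSY⟩ := hH Y ⟨hY.1.trans (filter_subset _ _), hY.2⟩
      -- It must be shown that `S ⊆ T`. The boundary of the excess `S \ T` lies in the minimal curve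
      -- `Z`, so it is empty or all of `Z`. In the second case the excess together with `T` would be
      -- a nonempty set without boundary.
      have hR : bd E (S \ T) ⊆ Z := by
        intro e he
        by_contra hne
        obtain ⟨τ, hτ, heτ⟩ := exists_mem_of_mem_bd he
        rw [mem_sdiff] at hτ
        have heE := bd_subset _ _ he
        have h1 : ∀ τ' ∈ T, ¬ e ⊆ τ' := fun τ' hτ' h =>
          hne (hs.mem_bd_of_mem_of_notMem hT heE hτ' (hS hτ.1) hτ.2 h heτ)
        have h2 : e ∈ Y := by
          rw [← hSY, mem_bd]
          refine ⟨heE, ?_⟩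
          have : cofaces S e = cofaces (S \ T) e := by
            ext x
            simp only [mem_cofaces, mem_sdiff]
            exact ⟨fun h => ⟨⟨h.1, fun hx => h1 x hx h.2⟩, h.2⟩, fun h => ⟨h.1.1, h.2⟩⟩
          rw [this]
          exact (mem_bd.1 he).2
        obtain ⟨-, τ', hτ', h'⟩ := mem_filter.1 (hY.1 h2)
        exact h1 τ' hτ' h'
      rcases hZ.minimal _ hR (hs.isCycle_bd (sdiff_subset.trans hS)) with h | h
      · have h0 := hinj _ (sdiff_subset.trans hS) h
        refine ⟨S, sdiff_eq_empty_iff_subset.1 h0, ?_⟩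
        ext e
        constructor
        · intro he
          rw [mem_bd] at he
          rw [← hSY, mem_bd]
          exact ⟨(mem_filter.1 he.1).1, he.2⟩
        · intro he
          have := hY.1 he
          rw [← hSY, mem_bd] at he
          exact mem_bd.2 ⟨this, he.2⟩
      · exfalso
        have h0 : (S \ T) ∆ T = ∅ := hinj _ (fun x hx => by
          rcases mem_symmDiff.1 hx with hx | hx
          exacts [hS (mem_sdiff.1 hx.1).1, hT hx.1]) (by
          rw [bd_symmDiff, h]; exact symmDiff_self _)
        obtain ⟨τ, hτ⟩ := hTne
        have : τ ∈ (S \ T) ∆ T := mem_symmDiff.2 (Or.inr ⟨hτ, fun h => (mem_sdiff.1 h).2 hτ⟩)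
        rw [h0] at this
        exact absurd this (notMem_empty _)
  -- The incidence counts that follow turn `6 * (#T + #V - #E')` into `6 * #V - 3 * #T - 3 * #Z`,
  -- which is the curvature sum.
  have c1 : 3 * #T + #Z = 2 * #E' := by
    have h1 := sum_card_bipartiteAbove_eq_sum_card_bipartiteBelow (s := E') (t := T)
      (fun e T => e ⊆ T)
    simp only [bipartiteAbove, bipartiteBelow] at h1
    rw [sum_const_nat (m := 3) (s := T)] at h1
    · have h2 : ∑ e ∈ E', (if e ∈ Z then 1 else 0) = #Z := by
        rw [← sum_filter, filter_mem_eq_inter, inter_eq_right.2 hZE', card_eq_sum_ones]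
      rw [mul_comm 3, ← h1, ← h2, ← sum_add_distrib, sum_const_nat (m := 2), mul_comm]
      intro e he
      rw [hE', mem_filter] at he
      obtain ⟨he, τ, hτ, heτ⟩ := he
      have h3 : 0 < #(cofaces T e) := card_pos.2 ⟨τ, mem_cofaces.2 ⟨hτ, heτ⟩⟩
      have h4 : #(cofaces T e) ≤ #(cofaces F e) := card_le_card (filter_subset_filter _ hT)
      have h5 := hs.card_cofaces_le e he
      have h6 : e ∈ Z ↔ Odd #(cofaces T e) := by rw [hZdef, mem_bd]; simp [he]
      rw [← cofaces]
      simp only [h6]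
      have h7 : #(cofaces T e) ≤ 2 := h4.trans h5
      interval_cases #(cofaces T e) <;> simp
    · intro τ hτ
      rw [← hs.card_edges_of_face (hT hτ)]
      congr 1
      ext e
      simp only [hE', mem_filter]
      exact ⟨fun h => ⟨h.1.1, h.2⟩, fun h => ⟨⟨h.1, τ, hτ, h.2⟩, h.2⟩⟩
  have c2 : ∑ w ∈ V, #(star T w) = 3 * #T := by
    have h1 := sum_card_bipartiteAbove_eq_sum_card_bipartiteBelow (s := V) (t := T)
      (fun w T => w ∈ T)
    simp only [bipartiteAbove, bipartiteBelow] at h1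
    simp only [star]
    rw [h1, sum_const_nat (m := 3), mul_comm]
    intro τ hτ
    rw [filter_mem_eq_inter, inter_eq_right.2 (show τ ⊆ V from fun x hx => mem_biUnion.2 ⟨τ, hτ, hx⟩),
      hs.card_face τ (hT hτ)]
  have c3 : ∑ w ∈ V, #(star Z w) = 2 * #Z := by
    have h1 := sum_card_bipartiteAbove_eq_sum_card_bipartiteBelow (s := V) (t := Z)
      (fun w T => w ∈ T)
    simp only [bipartiteAbove, bipartiteBelow] at h1
    simp only [star]
    rw [h1, sum_const_nat (m := 2), mul_comm]
    intro e he
    obtain ⟨he', τ, hτ, heτ⟩ := mem_filter.1 (hZE' he)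
    rw [filter_mem_eq_inter, inter_eq_right.2 (fun x hx => mem_biUnion.2 ⟨τ, hτ, heτ hx⟩),
      hs.card_edge e he']
  -- The degree of a vertex in `Z` is `0` or `2`, so twice the constant `6` or `3` is linear in that
  -- degree.
  have c4 : 2 * ∑ w ∈ V, (if (star Z w).Nonempty then (3 : ℤ) else 6) = 12 * #V - 6 * #Z := by
    have : ∀ w ∈ V, 2 * (if (star Z w).Nonempty then (3 : ℤ) else 6) = 12 - 3 * #(star Z w) := by
      intro w _
      have h1 := hZ.cycle.2 w
      have h2 := hZ.card_star_le w
      simp only [← card_pos]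
      interval_cases #(star Z w)
      · simp
      · exact absurd h1 (by decide)
      · simp
    rw [mul_sum, sum_congr rfl this, sum_sub_distrib, ← mul_sum, ← Nat.cast_sum, c3]
    simp only [sum_const, nsmul_eq_mul]
    push_cast
    ring
  rw [sum_sub_distrib, ← Nat.cast_sum, c2]
  push_cast
  omega

end IsTriangulatedSurface

end

/-! ### Balls around `v` and regions cut off by short paths. -/

section

variable {W : Type*}

/-- The triangles with a vertex of level less than `k`. -/
def ball (F : Finset (Finset W)) (lev : W → ℕ) (k : ℕ) : Finset (Finset W) :=
  {T ∈ F | ∃ u ∈ T, lev u < k}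

@[simp] lemma mem_ball {F : Finset (Finset W)} {lev : W → ℕ} {k : ℕ} {T : Finset W} :
    T ∈ ball F lev k ↔ T ∈ F ∧ ∃ u ∈ T, lev u < k := by simp [ball]

lemma ball_subset (F : Finset (Finset W)) (lev : W → ℕ) (k : ℕ) : ball F lev k ⊆ F :=
  filter_subset _ _

variable [DecidableEq W]

/-- A triangulated surface with the mod `2` homology of a disc and levels that behave like the
distance from `v`, in which the inner vertices have degree `t ≥ 6` and all vertices of level less
than `n` are inner. -/
structure IsLeveledDisc (E F : Finset (Finset W)) (v : W) (lev : W → ℕ) (n t : ℕ) : Prop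
    extends IsTriangulatedSurface E F where
  exists_bd : ∀ Y, IsCycle E Y → ∃ S ⊆ F, bd E S = Y
  bd_inj : ∀ S ⊆ F, bd E S = ∅ → S = ∅
  six_le : 6 ≤ t
  card_star : ∀ w, IsInner E F w → #(star F w) = t
  lev_eq_zero : ∀ w, lev w = 0 ↔ w = v
  lev_le : ∀ a b, {a, b} ∈ E → lev a ≤ lev b + 1
  exists_down : ∀ w k, lev w = k + 1 → ∃ u, {w, u} ∈ E ∧ lev u = k
  inner : ∀ w, lev w < n → IsInner E F w

/-- The ball of radius `k` is bounded by a simple closed curve through all vertices of level `k`,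
and has at most three triangles at each of them. -/
structure IsRoundBall (E F : Finset (Finset W)) (lev : W → ℕ) (k : ℕ) : Prop where
  circuit : IsCircuit E (bd E (ball F lev k))
  nonempty : ∀ w, lev w = k → (star (bd E (ball F lev k)) w).Nonempty
  card_star_le : ∀ w, lev w = k → #(star (ball F lev k) w) ≤ 3

lemma star_mono {S S' : Finset (Finset W)} (h : S ⊆ S') (w : W) : star S w ⊆ star S' w :=
  filter_subset_filter _ h

lemma star_singleton_pair (a b w : W) :
    #(star {({a, b} : Finset W)} w) = if w = a ∨ w = b then 1 else 0 := by
  simp only [star, filter_singleton, mem_insert, mem_singleton]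
  split_ifs <;> simp

open Classical in
/-- Two vertices of a simple closed curve are joined by a mod `2` path in it. -/
lemma IsCircuit.exists_path {E Z : Finset (Finset W)} (hE : ∀ e ∈ E, #e = 2) (hZ : IsCircuit E Z)
    {x y : W} (hx : (star Z x).Nonempty) (hy : (star Z y).Nonempty) :
    ∃ Z₁ ⊆ Z, ∀ w, Odd #(star Z₁ w) ↔ ¬ (w = x ↔ w = y) := by
  let P : W → Prop := fun y => ∃ Z₁ ⊆ Z, ∀ w, Odd #(star Z₁ w) ↔ ¬ (w = x ↔ w = y)
  have hPx : P x := ⟨∅, empty_subset _, fun w => by simp [star]⟩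
  have hP : ∀ e ∈ Z, ∀ a ∈ e, ∀ b ∈ e, P a → P b := by
    rintro e he a ha b hb ⟨Z₁, h₁, h⟩
    by_cases hab : a = b
    · exact hab ▸ ⟨Z₁, h₁, h⟩
    · have heq : e = {a, b} := (eq_of_subset_of_card_le (insert_subset ha
        (singleton_subset_iff.2 hb)) (by rw [hE e (hZ.cycle.1 he), card_pair hab])).symm
      subst heq
      refine ⟨Z₁ ∆ {{a, b}}, fun e' he' => ?_, fun w => ?_⟩
      · rcases mem_symmDiff.1 he' with h' | h'
        · exact h₁ h'.1
        · exact (mem_singleton.1 h'.1) ▸ he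
      · rw [odd_card_star_symmDiff, h w, star_singleton_pair]
        by_cases h1 : w = a
        · subst h1; simp [hab]
        · by_cases h2 : w = b
          · subst h2; simp [h1]
          · simp [h1, h2]
  -- The edges that touch a vertex reachable from `x` contain all or none of the edges at each
  -- vertex, so they form a nonempty subcycle; minimality makes it all of `Z`.
  have hY : {e ∈ Z | ∃ a ∈ e, P a} = Z := by
    refine (hZ.minimal _ (filter_subset _ _) ⟨(filter_subset _ _).trans hZ.cycle.1, fun w => ?_⟩
      ).resolve_left ?_
    · by_cases hw : P w
      · convert hZ.cycle.2 w using 2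
        ext e
        simp only [mem_star, mem_filter]
        exact ⟨fun h => ⟨h.1.1, h.2⟩, fun h => ⟨⟨h.1, w, h.2, hw⟩, h.2⟩⟩
      · suffices hemp : star {e ∈ Z | ∃ a ∈ e, P a} w = ∅ by rw [hemp]; simp
        rw [eq_empty_iff_forall_notMem]
        intro e he
        simp only [mem_star, mem_filter] at he
        obtain ⟨⟨he, a, ha, hPa⟩, hwe⟩ := he
        exact hw (hP e he a ha w hwe hPa)
    · obtain ⟨e, he⟩ := hx
      rw [mem_star] at he
      exact ne_empty_of_mem (a := e) (mem_filter.2 ⟨he.1, x, he.2, hPx⟩)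
  obtain ⟨e, he⟩ := hy
  rw [mem_star] at he
  obtain ⟨-, a, ha, hPa⟩ := mem_filter.1 (hY ▸ he.1)
  exact hP e he.1 a ha y he.2 hPa

namespace IsLeveledDisc

variable {E F : Finset (Finset W)} {v : W} {lev : W → ℕ} {n t : ℕ}
  (h : IsLeveledDisc E F v lev n t)

include h

lemma lev_le_of_mem {T : Finset W} (hT : T ∈ F) {a b : W} (ha : a ∈ T) (hb : b ∈ T) :
    lev a ≤ lev b + 1 := by
  by_cases hab : a = b
  · subst hab; omega
  · exact h.lev_le a b (h.pair_mem hT ha hb hab)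

/-- An endpoint of level less than `k` would be inner and would put both triangles of the edge into
the ball. -/
lemma lev_of_mem_bd_ball {k : ℕ} (hk : k ≤ n) {e : Finset W} (he : e ∈ bd E (ball F lev k))
    {w : W} (hw : w ∈ e) : lev w = k := by
  obtain ⟨T, hT, heT⟩ := exists_mem_of_mem_bd he
  obtain ⟨hTF, u, hu, hlt⟩ := mem_ball.1 hT
  have h1 := h.lev_le_of_mem hTF (heT hw) hu
  by_contra hne
  have hlt' : lev w < k := by omega
  have h2 := h.inner w (by omega) e (bd_subset _ _ he) hw
  have h3 : cofaces (ball F lev k) e = cofaces F e := by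
    ext x
    simp only [mem_cofaces, mem_ball]
    exact ⟨fun hx => ⟨hx.1.1, hx.2⟩, fun hx => ⟨⟨hx.1, w, hx.2 hw, hlt'⟩, hx.2⟩⟩
  have h4 := (mem_bd.1 he).2
  rw [h3, h2] at h4
  exact absurd h4 (by decide)

/-- A set of triangles whose boundary stays outside the ball contains all of it or nothing. -/
lemma ball_dichotomy {k : ℕ} {S : Finset (Finset W)} (hS : S ⊆ F)
    (hb : ∀ e ∈ bd E S, ∀ w ∈ e, k ≤ lev w) : Disjoint S (ball F lev k) ∨ ball F lev k ⊆ S := by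
  have h1 : ∀ u, lev u < k → ∀ T ∈ S, u ∈ T → ∀ T' ∈ F, u ∈ T' → T' ∈ S := by
    intro u hu T hT huT T' hT' hu'
    refine h.star_subset hS (fun e he hue => ?_) hT huT hT' hu'
    have := hb e he u hue
    omega
  have h2 : ∀ m, ∀ u, lev u = m → lev u < k →
      ((∀ T ∈ F, u ∈ T → T ∈ S) ↔ ∀ T ∈ F, v ∈ T → T ∈ S) := by
    intro m
    induction m with
    | zero => intro u hu _; rw [(h.lev_eq_zero u).1 hu]
    | succ m ih =>
      intro u hu hk
      obtain ⟨u', hu', hl⟩ := h.exists_down u m hu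
      obtain ⟨T₀, h₀, s₀⟩ := h.exists_face _ hu'
      have m1 : u ∈ T₀ := s₀ (by simp)
      have m2 : u' ∈ T₀ := s₀ (by simp)
      rw [← ih u' hl (by omega)]
      exact ⟨fun hT => h1 u' (by omega) T₀ (hT T₀ h₀ m1) m2,
        fun hT => h1 u hk T₀ (hT T₀ h₀ m2) m1⟩
  by_cases hd : Disjoint S (ball F lev k)
  · exact Or.inl hd
  · right
    obtain ⟨T, hT, hT'⟩ := not_disjoint_iff.1 hd
    obtain ⟨hTF, u, hu, hlt⟩ := mem_ball.1 hT'
    have h3 := (h2 _ u rfl hlt).1 (h1 u hlt T hT hu)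
    intro T₁ h₁
    obtain ⟨hF₁, u₁, hu₁, hlt₁⟩ := mem_ball.1 h₁
    exact (h2 _ u₁ rfl hlt₁).2 h3 T₁ hF₁ hu₁

/-- A path `Q` outside a round ball that joins two vertices of its boundary cuts off a region in
which only the vertices of `Q` carry positive curvature. -/
lemma exists_region {k : ℕ} (hk : k ≤ n) (hB : IsRoundBall E F lev k) {x y : W} (hxy : x ≠ y)
    (hx : lev x = k) (hy : lev y = k) {Q : Finset (Finset W)} (hQE : Q ⊆ E)
    (hQlev : ∀ e ∈ Q, ∀ w ∈ e, k ≤ lev w) (hQd : Disjoint (bd E (ball F lev k)) Q)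
    (hQk : ∀ w, lev w = k → #(star Q w) = if w = x ∨ w = y then 1 else 0)
    (hQn : ∀ w, lev w ≠ k → Even #(star Q w) ∧ #(star Q w) ≤ 2)
    (hQm : ∀ Y ⊆ Q, (∀ w, lev w ≠ k → Even #(star Y w)) → Y = ∅ ∨ Y = Q) :
    ∃ T ⊆ F, Q ⊆ bd E T ∧ (∀ w ∈ Q.biUnion id, 1 ≤ #(star T w)) ∧
      (6 : ℤ) ≤ ∑ w ∈ Q.biUnion id, (3 - (#(star T w) : ℤ)) := by
  set N := ball F lev k with hN
  set Z := bd E N with hZ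
  have hNF : N ⊆ F := ball_subset _ _ _
  have hlevZ : ∀ e ∈ Z, ∀ w ∈ e, lev w = k := fun e he w hw => h.lev_of_mem_bd_ball hk he hw
  have hQodd : ∀ w, Odd #(star Q w) ↔ ¬ (w = x ↔ w = y) := by
    intro w
    by_cases hw : lev w = k
    · rw [hQk w hw]
      by_cases h1 : w = x
      · subst h1; simp [hxy]
      · by_cases h2 : w = y
        · subst h2; simp [h1]
        · simp [h1, h2]
    · have h1 : w ≠ x := fun h' => hw (h' ▸ hx)
      have h2 : w ≠ y := fun h' => hw (h' ▸ hy)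
      simpa [h1, h2] using (hQn w hw).1
  have hQx : (star Q x).Nonempty := by rw [← card_pos, hQk x hx]; simp
  have hQy : (star Q y).Nonempty := by rw [← card_pos, hQk y hy]; simp
  obtain ⟨T, hTF, hTN, Z₁, hZ₁, hodd, hbd⟩ : ∃ T ⊆ F, Disjoint T N ∧ ∃ Z₁ ⊆ Z,
      (∀ w, Odd #(star Z₁ w) ↔ ¬ (w = x ↔ w = y)) ∧ bd E T = Z₁ ∆ Q := by
    obtain ⟨Z₁, hZ₁, hodd⟩ := hB.circuit.exists_path h.card_edge (hB.nonempty x hx)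
      (hB.nonempty y hy)
    have hc : IsCycle E (Z₁ ∆ Q) := by
      refine ⟨fun e he => ?_, fun w => ?_⟩
      · rcases mem_symmDiff.1 he with he | he
        exacts [hB.circuit.cycle.1 (hZ₁ he.1), hQE he.1]
      · rw [← Nat.not_odd_iff_even, odd_card_star_symmDiff, hodd, hQodd]; simp
    obtain ⟨T, hT, hbT⟩ := h.exists_bd _ hc
    have hdich : Disjoint T N ∨ N ⊆ T := by
      refine h.ball_dichotomy hT fun e he w hw => ?_
      rw [hbT] at he
      rcases mem_symmDiff.1 he with he | he
      exacts [(hlevZ e (hZ₁ he.1) w hw).ge, hQlev e he.1 w hw]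
    rcases hdich with hd | hd
    · exact ⟨T, hT, hd, Z₁, hZ₁, hodd, hbT⟩
    -- If the region swallows the ball, remove the ball and replace the arc `Z₁` by the
    -- complementary arc of `Z`.
    · refine ⟨T \ N, sdiff_subset.trans hT, sdiff_disjoint, Z₁ ∆ Z, fun e he => ?_, fun w => ?_, ?_⟩
      · rcases mem_symmDiff.1 he with he | he
        exacts [hZ₁ he.1, he.1]
      · have := hB.circuit.cycle.2 w
        rw [← Nat.not_odd_iff_even] at this
        rw [odd_card_star_symmDiff, hodd]
        tauto
      · rw [← symmDiff_eq_sdiff hd, bd_symmDiff, hbT, symmDiff_right_comm]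
  have hZ₁Q : Disjoint Z₁ Q := hQd.mono_left hZ₁
  rw [symmDiff_eq_union hZ₁Q] at hbd
  have hQT : Q ⊆ bd E T := hbd ▸ subset_union_right
  have hZ₁ne : Z₁ ≠ Z := by
    rintro rfl
    have h1 := (hodd x).2 (by simp [hxy])
    exact absurd h1 (Nat.not_odd_iff_even.2 (hB.circuit.cycle.2 x))
  have hsub : ∀ Y ⊆ Z₁, IsCycle E Y → Y = ∅ := fun Y hY hc =>
    (hB.circuit.minimal Y (hY.trans hZ₁) hc).resolve_right
      (fun h' => hZ₁ne (hZ₁.antisymm (h'.symm.subset.trans hY)))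
  -- A subcycle contains none or all of `Q`. In the first case it lies in the proper part `Z₁` of
  -- the curve and is empty; in the second the same holds for its complement.
  have hcirc : IsCircuit E (bd E T) := by
    refine ⟨h.isCycle_bd hTF, ?_, ?_, ?_⟩
    · obtain ⟨e, he⟩ := hQx
      exact ⟨e, hQT (mem_star.1 he).1⟩
    · intro Y hY hc
      rw [hbd] at hY
      rcases hQm (Y ∩ Q) inter_subset_right (fun w hw => by
        convert hc.2 w using 2
        ext e
        simp only [mem_star, mem_inter]
        refine ⟨fun he => ⟨he.1.1, he.2⟩, fun he => ⟨⟨he.1, ?_⟩, he.2⟩⟩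
        exact (mem_union.1 (hY he.1)).resolve_left
          fun h' => hw (hlevZ e (hZ₁ h') w he.2)) with h1 | h1
      · left
        refine hsub Y (fun e he => ?_) hc
        refine (mem_union.1 (hY he)).resolve_right fun h' => ?_
        have : e ∈ Y ∩ Q := mem_inter.2 ⟨he, h'⟩
        rw [h1] at this
        exact absurd this (notMem_empty _)
      · right
        have h2 : Y ∆ bd E T = ∅ := by
          refine hsub _ (fun e he => ?_) (hc.symmDiff (h.isCycle_bd hTF))
          have hQY : e ∈ Q → e ∈ Y := fun h' => (mem_inter.1 (h1.symm ▸ h')).1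
          rw [hbd, mem_symmDiff, mem_union] at he
          have := @hY e
          rw [mem_union] at this
          tauto
        exact symmDiff_eq_bot.1 h2
    · intro w
      rw [hbd, star, filter_union]
      refine (card_union_le _ _).trans ?_
      change #(star Z₁ w) + #(star Q w) ≤ 2
      by_cases hw : lev w = k
      · have h1 : #(star Z₁ w) ≤ 2 :=
          (card_le_card (star_mono hZ₁ w)).trans (hB.circuit.card_star_le w)
        have h2 := hodd w
        rw [hQk w hw]
        by_cases hwxy : w = x ∨ w = y
        · rw [if_pos hwxy]
          have h3 : Odd #(star Z₁ w) := h2.2 (by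
            rcases hwxy with rfl | rfl
            · simp [hxy]
            · simp [hxy.symm])
          obtain ⟨m, hm⟩ := h3
          omega
        · rw [if_neg hwxy]; omega
      · have : star Z₁ w = ∅ := by
          rw [eq_empty_iff_forall_notMem]
          intro e he
          rw [mem_star] at he
          exact hw (hlevZ e (hZ₁ he.1) w he.2)
        rw [this]
        simpa using (hQn w hw).2
  have hpos : ∀ w ∈ Q.biUnion id, 1 ≤ #(star T w) := by
    intro w hw
    obtain ⟨e, he, hwe⟩ := mem_biUnion.1 hw
    obtain ⟨τ, hτ, heτ⟩ := exists_mem_of_mem_bd (hQT he)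
    exact card_pos.2 ⟨τ, mem_star.2 ⟨hτ, heτ hwe⟩⟩
  refine ⟨T, hTF, hQT, hpos, ?_⟩
  have hgb := h.gauss_bonnet h.exists_bd h.bd_inj hTF hcirc
  have hVsub : Q.biUnion id ⊆ T.biUnion id := by
    intro w hw
    obtain ⟨e, he, hwe⟩ := mem_biUnion.1 hw
    obtain ⟨τ, hτ, heτ⟩ := exists_mem_of_mem_bd (hQT he)
    exact mem_biUnion.2 ⟨τ, hτ, heτ hwe⟩
  refine hgb.trans ?_
  rw [← sum_sdiff hVsub]
  have hA : ∑ w ∈ T.biUnion id \ Q.biUnion id,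
      ((if (star (bd E T) w).Nonempty then 3 else 6) - (#(star T w) : ℤ)) ≤ 0 := by
    refine sum_nonpos fun w hw => ?_
    obtain ⟨hwT, hwQ⟩ := mem_sdiff.1 hw
    obtain ⟨τ, hτ, hwτ⟩ := mem_biUnion.1 hwT
    have hwQ' : ∀ e ∈ Q, w ∉ e := fun e he hwe => hwQ (mem_biUnion.2 ⟨e, he, hwe⟩)
    have ht := h.six_le
    -- A vertex on the arc, other than `x` and `y`, is surrounded by `T ∪ N`: of its `t` triangles
    -- at most three are in `N`, so at least three are in `T`. A vertex off the boundary has all its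
    -- `t ≥ 6` triangles in `T`.
    split_ifs with hne
    · have hwx : w ≠ x := by
        rintro rfl
        obtain ⟨e, he⟩ := hQx
        rw [mem_star] at he
        exact hwQ' e he.1 he.2
      have hwy : w ≠ y := by
        rintro rfl
        obtain ⟨e, he⟩ := hQy
        rw [mem_star] at he
        exact hwQ' e he.1 he.2
      obtain ⟨e, he⟩ := hne
      rw [mem_star, hbd] at he
      have heZ₁ : e ∈ Z₁ := (mem_union.1 he.1).resolve_right fun h' => hwQ' e h' he.2
      have hlw : lev w = k := hlevZ e (hZ₁ heZ₁) w he.2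
      have hstar : star Z₁ w = star Z w := by
        refine eq_of_subset_of_card_le (star_mono hZ₁ w) ?_
        have h1 : #(star Z w) ≤ 2 := hB.circuit.card_star_le w
        have h2 : ¬ Odd #(star Z₁ w) := by rw [hodd]; simp [hwx, hwy]
        have h3 : 0 < #(star Z₁ w) := card_pos.2 ⟨e, mem_star.2 ⟨heZ₁, he.2⟩⟩
        obtain ⟨m, hm⟩ := Nat.not_odd_iff_even.1 h2
        omega
      have hS : T ∪ N ⊆ F := union_subset hTF hNF
      have hSb : ∀ e ∈ bd E (T ∪ N), w ∉ e := by
        intro e' he' hwe'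
        rw [← symmDiff_eq_union hTN, bd_symmDiff, hbd, mem_symmDiff, mem_union] at he'
        have h1 : e' ∈ Z → e' ∈ Z₁ := fun h' =>
          (mem_star.1 (hstar.symm ▸ mem_star.2 ⟨h', hwe'⟩ : e' ∈ star Z₁ w)).1
        have h2 := @hZ₁ e'
        have h3 := hwQ' e'
        tauto
      have h4 := h.star_eq hS hSb (mem_union_left _ hτ) hwτ
      have h5 := h.card_star w (h.isInner_of_star hS hSb (mem_union_left _ hτ) hwτ)
      rw [← h4, star, filter_union] at h5
      have h6 := card_union_le (star T w) (star N w)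
      rw [star, star, h5] at h6
      have h7 := hB.card_star_le w hlw
      simp only [star, ← hN] at h6 h7 ⊢
      omega
    · have hb : ∀ e ∈ bd E T, w ∉ e := fun e he hwe => hne ⟨e, mem_star.2 ⟨he, hwe⟩⟩
      have h4 := h.star_eq hTF hb hτ hwτ
      have h5 := h.card_star w (h.isInner_of_star hTF hb hτ hwτ)
      rw [h4, h5]
      omega
  have hBq : ∑ w ∈ Q.biUnion id,
      ((if (star (bd E T) w).Nonempty then 3 else 6) - (#(star T w) : ℤ)) =
      ∑ w ∈ Q.biUnion id, (3 - (#(star T w) : ℤ)) := by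
    refine sum_congr rfl fun w hw => ?_
    obtain ⟨e, he, hwe⟩ := mem_biUnion.1 hw
    rw [if_pos ⟨e, mem_star.2 ⟨hQT he, hwe⟩⟩]
  rw [hBq]
  linarith

end IsLeveledDisc

end

/-! ### Growth of round balls. -/

section

variable {W : Type*} [DecidableEq W]

/-- The triangles with a vertex of level less than `k` that meet the edge set `Y`. -/
def fan (F : Finset (Finset W)) (lev : W → ℕ) (k : ℕ) (Y : Finset (Finset W)) :
    Finset (Finset W) :=
  {T ∈ ball F lev k | ∃ e ∈ Y, ∃ u ∈ e, u ∈ T}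

/-- Any two neighbours of level `k` of a vertex of level `k + 1` span a triangle with it. -/
def DownLinked (E F : Finset (Finset W)) (lev : W → ℕ) (k : ℕ) : Prop :=
  ∀ w x y, lev w = k + 1 → lev x = k → lev y = k → x ≠ y → {w, x} ∈ E → {w, y} ∈ E →
    {w, x, y} ∈ F

lemma fan_subset (F : Finset (Finset W)) (lev : W → ℕ) (k : ℕ) (Y : Finset (Finset W)) :
    fan F lev k Y ⊆ ball F lev k := filter_subset _ _

lemma mem_fan {F : Finset (Finset W)} {lev : W → ℕ} {k : ℕ} {Y : Finset (Finset W)}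
    {T : Finset W} : T ∈ fan F lev k Y ↔ T ∈ ball F lev k ∧ ∃ e ∈ Y, ∃ u ∈ e, u ∈ T := by
  simp [fan]

namespace IsLeveledDisc

variable {E F : Finset (Finset W)} {v : W} {lev : W → ℕ} {n t : ℕ}
  (h : IsLeveledDisc E F v lev n t)

include h

/-- Three triangles pairwise sharing an edge at `w` close up around it, so `w` would be inner of
degree at most three, against `t ≥ 6`. -/
lemma not_three_faces {w a b c : W} (hab : a ≠ b) (hac : a ≠ c) (hbc : b ≠ c)
    (h₁ : {w, a, b} ∈ F) (h₂ : {w, b, c} ∈ F) (h₃ : {w, a, c} ∈ F) : False := by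
  have hne : ∀ x y, ({w, x, y} : Finset W) ∈ F → x ≠ w ∧ y ≠ w := by
    intro x y hF
    have h3 := h.card_face _ hF
    constructor
    · intro hxw
      rw [hxw, insert_eq_of_mem (mem_insert_self _ _)] at h3
      have := card_le_two (a := w) (b := y)
      omega
    · intro hyw
      rw [hyw, pair_comm, insert_eq_of_mem (mem_insert_self _ _)] at h3
      have := card_le_two (a := w) (b := x)
      omega
  obtain ⟨haw, hbw⟩ := hne _ _ h₁
  obtain ⟨-, hcw⟩ := hne _ _ h₂
  have d₁₂ : ({w, a, b} : Finset W) ≠ {w, b, c} := fun heq => by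
    have : a ∈ ({w, b, c} : Finset W) := heq ▸ (by simp)
    simp [haw, hab, hac] at this
  have d₁₃ : ({w, a, b} : Finset W) ≠ {w, a, c} := fun heq => by
    have : b ∈ ({w, a, c} : Finset W) := heq ▸ (by simp)
    simp [hbw, hab.symm, hbc] at this
  have d₂₃ : ({w, b, c} : Finset W) ≠ {w, a, c} := fun heq => by
    have : b ∈ ({w, a, c} : Finset W) := heq ▸ (by simp)
    simp [hbw, hab.symm, hbc] at this
  set S : Finset (Finset W) := {{w, a, b}, {w, b, c}, {w, a, c}} with hSdef
  have hS : S ⊆ F := by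
    intro x hx
    simp only [hSdef, mem_insert, mem_singleton] at hx
    rcases hx with rfl | rfl | rfl <;> assumption
  have m₁ : {w, a, b} ∈ S := by simp [hSdef]
  have m₂ : {w, b, c} ∈ S := by simp [hSdef]
  have m₃ : {w, a, c} ∈ S := by simp [hSdef]
  have hb : ∀ e ∈ bd E S, w ∉ e := by
    intro e he hwe
    obtain ⟨p, hp, rfl⟩ := h.exists_eq_pair (bd_subset _ _ he) hwe
    obtain ⟨T, hT, hpT⟩ := exists_mem_of_mem_bd he
    have hpT' : p ∈ T := hpT (by simp)
    have : p = a ∨ p = b ∨ p = c := by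
      simp only [hSdef, mem_insert, mem_singleton] at hT
      rcases hT with rfl | rfl | rfl <;> simp [hp] at hpT' <;> tauto
    rcases this with rfl | rfl | rfl
    · exact h.notMem_bd_of_two hS m₁ m₃ d₁₃ (by simp [insert_subset_iff])
        (by simp [insert_subset_iff]) he
    · exact h.notMem_bd_of_two hS m₁ m₂ d₁₂ (by simp [insert_subset_iff])
        (by simp [insert_subset_iff]) he
    · exact h.notMem_bd_of_two hS m₂ m₃ d₂₃ (by simp [insert_subset_iff])
        (by simp [insert_subset_iff]) he
  have hw : w ∈ ({w, a, b} : Finset W) := by simp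
  have h4 := h.card_star w (h.isInner_of_star hS hb m₁ hw)
  rw [← h.star_eq hS hb m₁ hw] at h4
  have h5 : #(star S w) ≤ #S := card_filter_le _ _
  have h6 : #S ≤ 3 := card_le_three
  have := h.six_le
  omega

/-- The third vertices of two such triangles would be neighbours of `p` on level `k`; the triangle
that they span with `p` closes up three triangles around `p`. -/
lemma card_cofaces_ball_le_one {k : ℕ} (hd : DownLinked E F lev k) {p q : W}
    (he : {p, q} ∈ E) (hp : lev p = k + 1) (hq : lev q = k + 1) :
    #(cofaces (ball F lev (k + 1)) {p, q}) ≤ 1 := by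
  by_contra! hlt
  obtain ⟨T₁, h₁, T₂, h₂, hne⟩ := one_lt_card.1 hlt
  rw [mem_cofaces, mem_ball] at h₁ h₂
  have hpq := h.ne_of_pair_mem he
  have key : ∀ T ∈ F, (∃ u ∈ T, lev u < k + 1) → {p, q} ⊆ T →
      ∃ c, lev c = k ∧ T = {p, q, c} ∧ {p, c} ∈ E ∧ c ≠ q := by
    rintro T hT ⟨u, hu, hlu⟩ hs
    have hpT : p ∈ T := hs (by simp)
    have hqT : q ∈ T := hs (by simp)
    have hup : p ≠ u := by rintro rfl; omega
    have huq : q ≠ u := by rintro rfl; omega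
    have := h.lev_le_of_mem hT hpT hu
    exact ⟨u, by omega, h.face_eq hT hpT hqT hu hpq hup huq, h.pair_mem hT hpT hu hup, huq.symm⟩
  obtain ⟨c₁, l₁, e₁, m₁, n₁⟩ := key T₁ h₁.1.1 h₁.1.2 h₁.2
  obtain ⟨c₂, l₂, e₂, m₂, n₂⟩ := key T₂ h₂.1.1 h₂.1.2 h₂.2
  have hc : c₁ ≠ c₂ := fun heq => hne (by rw [e₁, e₂, heq])
  exact h.not_three_faces n₁.symm n₂.symm hc (e₁ ▸ h₁.1.1) (hd p c₁ c₂ hp l₁ l₂ hc m₁ m₂)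
    (e₂ ▸ h₂.1.1)

lemma mem_bd_ball {k : ℕ} (hd : DownLinked E F lev k) {p q : W} (hpq : p ≠ q)
    (hp : lev p = k + 1) (hq : lev q = k + 1) {T : Finset W} (hT : T ∈ ball F lev (k + 1))
    (hpT : p ∈ T) (hqT : q ∈ T) : {p, q} ∈ bd E (ball F lev (k + 1)) := by
  have he := h.pair_mem (mem_ball.1 hT).1 hpT hqT hpq
  have h1 := h.card_cofaces_ball_le_one hd he hp hq
  have h2 : 0 < #(cofaces (ball F lev (k + 1)) {p, q}) :=
    card_pos.2 ⟨T, mem_cofaces.2 ⟨hT, insert_subset hpT (singleton_subset_iff.2 hqT)⟩⟩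
  rw [mem_bd, show #(cofaces (ball F lev (k + 1)) {p, q}) = 1 by omega]
  exact ⟨he, odd_one⟩

/-- The shape of the link of a vertex of level `k + 1` inside the ball. -/
lemma card_star_bd_ball {k : ℕ} (hk : k + 1 ≤ n) (hd : DownLinked E F lev k) {w : W}
    (hw : lev w = k + 1) :
    #(star (bd E (ball F lev (k + 1))) w) = 2 ∧ #(star (ball F lev (k + 1)) w) ≤ 3 := by
  set N := ball F lev (k + 1) with hN
  have hNF : N ⊆ F := ball_subset _ _ _
  set X := {e ∈ star E w | ∃ u ∈ e, lev u = k} with hX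
  have hXe : ∀ e ∈ X, ∃ u, lev u = k ∧ u ≠ w ∧ e = {w, u} ∧ {w, u} ∈ E := by
    intro e he
    obtain ⟨he', u, hu, hlu⟩ := mem_filter.1 he
    obtain ⟨heE, hwe⟩ := mem_star.1 he'
    have huw : u ≠ w := by rintro rfl; omega
    have := h.eq_of_subset heE huw.symm hwe hu
    exact ⟨u, hlu, huw, this, this ▸ heE⟩
  have hX2 : ∀ e ∈ X, #(cofaces N e) = 2 := by
    intro e he
    obtain ⟨u, hlu, -, rfl, huE⟩ := hXe e he
    have h1 := h.inner u (by omega) _ huE (by simp)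
    rw [← h1]
    congr 1
    ext T
    simp only [mem_cofaces, hN, mem_ball]
    exact ⟨fun hT => ⟨hT.1.1, hT.2⟩, fun hT => ⟨⟨hT.1, u, hT.2 (by simp), by omega⟩, hT.2⟩⟩
  have hX1 : ∀ e ∈ star E w, e ∉ X → #(cofaces N e) ≤ 1 := by
    intro e he heX
    obtain ⟨heE, hwe⟩ := mem_star.1 he
    obtain ⟨u, huw, rfl⟩ := h.exists_eq_pair heE hwe
    by_cases hpos : #(cofaces N {w, u}) = 0
    · omega
    · obtain ⟨T, hT⟩ := card_pos.1 (Nat.pos_of_ne_zero hpos)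
      rw [mem_cofaces, hN, mem_ball] at hT
      obtain ⟨⟨hTF, c, hc, hlc⟩, hsT⟩ := hT
      have h1 := h.lev_le_of_mem hTF (hsT (show u ∈ {w, u} by simp)) hc
      have h2 := h.lev_le w u heE
      have h3 : lev u ≠ k := fun h' => heX (mem_filter.2 ⟨he, u, by simp, h'⟩)
      exact h.card_cofaces_ball_le_one hd heE hw (by omega)
  have hstarX : ∀ T ∈ star N w, ∃ e ∈ X, e ⊆ T := by
    intro T hT
    rw [mem_star, hN, mem_ball] at hT
    obtain ⟨⟨hTF, c, hc, hlc⟩, hwT⟩ := hT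
    have hcw : w ≠ c := by rintro rfl; omega
    have h1 := h.lev_le_of_mem hTF hwT hc
    exact ⟨{w, c}, mem_filter.2 ⟨mem_star.2 ⟨h.pair_mem hTF hwT hc hcw, by simp⟩, c, by simp,
      by omega⟩, insert_subset hwT (singleton_subset_iff.2 hc)⟩
  have hsub : ∀ e ∈ X, cofaces N e ⊆ star N w := by
    intro e he T hT
    rw [mem_cofaces] at hT
    obtain ⟨u, -, -, rfl, -⟩ := hXe e he
    exact mem_star.2 ⟨hT.1, hT.2 (by simp)⟩
  -- Each triangle of the ball at `w` has two edges at `w`. The edges of `X` lie in two triangles of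
  -- the ball, the others in one (the boundary edges) or none.
  have hcount : #(star (bd E N) w) + 2 * #X = 2 * #(star N w) := by
    rw [← h.sum_cofaces_star hNF w, ← sum_filter_add_sum_filter_not (star E w) (· ∈ X),
      add_comm, show {e ∈ star E w | e ∈ X} = X by
        rw [filter_mem_eq_inter]; exact inter_eq_right.2 (filter_subset _ _),
      sum_const_nat hX2, mul_comm 2]
    congr 1
    rw [← sum_filter_ne_zero, sum_const_nat (m := 1), mul_one]
    · congr 1
      ext e
      simp only [mem_star, mem_bd, mem_filter]
      constructor
      · rintro ⟨⟨heE, ho⟩, hwe⟩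
        refine ⟨⟨⟨heE, hwe⟩, fun heX => ?_⟩, ?_⟩
        · rw [hX2 e heX] at ho
          exact absurd ho (by decide)
        · rintro h0
          rw [h0] at ho
          exact absurd ho (by decide)
      · rintro ⟨⟨⟨heE, hwe⟩, heX⟩, h0⟩
        have h1 := hX1 e (mem_star.2 ⟨heE, hwe⟩) heX
        rw [show #(cofaces N e) = 1 by omega]
        exact ⟨⟨heE, odd_one⟩, hwe⟩
    · intro e he
      obtain ⟨he, h0⟩ := mem_filter.1 he
      obtain ⟨he, heX⟩ := mem_filter.1 he
      have := hX1 e he heX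
      omega
  obtain ⟨u₁, hu₁, hl₁⟩ := h.exists_down w k hw
  have m₁ : {w, u₁} ∈ X := mem_filter.2 ⟨mem_star.2 ⟨hu₁, by simp⟩, u₁, by simp, hl₁⟩
  by_cases hone : X = {{w, u₁}}
  · have h1 : star N w = cofaces N {w, u₁} := by
      refine Subset.antisymm (fun T hT => ?_) (hsub _ m₁)
      obtain ⟨e, he, heT⟩ := hstarX T hT
      rw [hone, mem_singleton] at he
      exact mem_cofaces.2 ⟨(mem_star.1 hT).1, he ▸ heT⟩
    rw [h1, hX2 _ m₁, hone, card_singleton] at hcount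
    rw [h1, hX2 _ m₁]
    omega
  · obtain ⟨e₂, he₂, hne⟩ : ∃ e ∈ X, e ≠ {w, u₁} := by
      by_contra! hall
      exact hone (eq_singleton_iff_unique_mem.2 ⟨m₁, hall⟩)
    obtain ⟨u₂, hl₂, hu₂w, rfl, hu₂⟩ := hXe e₂ he₂
    have h12 : u₁ ≠ u₂ := by rintro rfl; exact hne rfl
    have hF := hd w u₁ u₂ hw hl₁ hl₂ h12 hu₁ hu₂
    have htwo : X = {{w, u₁}, {w, u₂}} := by
      ext e
      simp only [mem_insert, mem_singleton]
      constructor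
      · intro he
        obtain ⟨u₃, hl₃, hu₃w, rfl, hu₃⟩ := hXe e he
        by_contra! hcon
        have h13 : u₁ ≠ u₃ := by rintro rfl; exact hcon.1 rfl
        have h23 : u₂ ≠ u₃ := by rintro rfl; exact hcon.2 rfl
        exact h.not_three_faces h12 h13 h23 hF (hd w u₂ u₃ hw hl₂ hl₃ h23 hu₂ hu₃)
          (hd w u₁ u₃ hw hl₁ hl₃ h13 hu₁ hu₃)
      · rintro (rfl | rfl) <;> assumption
    have h1 : star N w = cofaces N {w, u₁} ∪ cofaces N {w, u₂} := by
      refine Subset.antisymm (fun T hT => ?_) (union_subset (hsub _ m₁) (hsub _ he₂))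
      obtain ⟨e, he, heT⟩ := hstarX T hT
      rw [htwo, mem_insert, mem_singleton] at he
      rw [mem_union, mem_cofaces, mem_cofaces]
      rcases he with rfl | rfl
      exacts [Or.inl ⟨(mem_star.1 hT).1, heT⟩, Or.inr ⟨(mem_star.1 hT).1, heT⟩]
    have h2 : cofaces N {w, u₁} ∩ cofaces N {w, u₂} = {{w, u₁, u₂}} := by
      ext T
      simp only [mem_inter, mem_cofaces, mem_singleton]
      constructor
      · rintro ⟨⟨hT, s₁⟩, -, s₂⟩
        exact h.face_eq (hNF hT) (s₁ (by simp)) (s₁ (by simp)) (s₂ (by simp))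
          (h.ne_of_pair_mem hu₁) hu₂w.symm h12
      · rintro rfl
        have : {w, u₁, u₂} ∈ N := mem_ball.2 ⟨hF, u₁, by simp, by omega⟩
        exact ⟨⟨this, by simp [insert_subset_iff]⟩, this, by simp [insert_subset_iff]⟩
    -- Two spokes share one triangle: `2 + 2 - 1 = 3` triangles, hence `2 * 3 - 2 * 2 = 2` boundary
    -- edges.
    have h3 := card_union_add_card_inter (cofaces N {w, u₁}) (cofaces N {w, u₂})
    rw [← h1, h2, hX2 _ m₁, hX2 _ he₂, card_singleton] at h3
    rw [htwo, card_pair hne.symm] at hcount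
    omega

/-- The boundary of the ball has degree two at `u`, and the even positive degree of `Y` there must
use both edges. -/
lemma mem_of_isCycle {k : ℕ} (hk : k + 1 ≤ n) (hd : DownLinked E F lev k)
    {Y : Finset (Finset W)} (hY : Y ⊆ bd E (ball F lev (k + 1))) (hc : IsCycle E Y)
    {e e' : Finset W} {u : W} (he : e ∈ Y) (hu : u ∈ e) (he' : e' ∈ bd E (ball F lev (k + 1)))
    (hu' : u ∈ e') : e' ∈ Y := by
  have h1 := (h.card_star_bd_ball hk hd (h.lev_of_mem_bd_ball hk (hY he) hu)).1
  have h2 : 0 < #(star Y u) := card_pos.2 ⟨e, mem_star.2 ⟨he, hu⟩⟩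
  obtain ⟨m, hm⟩ := hc.2 u
  have h3 : star Y u = star (bd E (ball F lev (k + 1))) u :=
    eq_of_subset_of_card_le (star_mono hY u) (by omega)
  exact (mem_star.1 (h3.symm ▸ mem_star.2 ⟨he', hu'⟩ : e' ∈ star Y u)).1

lemma subset_bd_fan {k : ℕ} {Y : Finset (Finset W)} (hY : Y ⊆ bd E (ball F lev k)) :
    Y ⊆ bd E (fan F lev k Y) := by
  intro e he
  obtain ⟨heE, ho⟩ := mem_bd.1 (hY he)
  refine mem_bd.2 ⟨heE, ?_⟩
  convert ho using 2
  ext T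
  simp only [mem_cofaces, mem_fan]
  refine ⟨fun hT => ⟨hT.1.1, hT.2⟩, fun hT => ⟨⟨hT.1, e, he, ?_⟩, hT.2⟩⟩
  have : 0 < #e := by rw [h.card_edge e heE]; norm_num
  obtain ⟨u, hu⟩ := card_pos.1 this
  exact ⟨u, hu, hT.2 hu⟩

/-- Triangles of the fan live on levels `k` and `k + 1`. An edge on the upper level belongs to the
sphere and joins up with `Y`, so it is in `Y`. For an edge between the levels, the lower end is
inner and the upper end is on `Y`, so both its triangles are in the fan. -/
lemma lev_of_mem_bd_fan {k : ℕ} (hk : k + 1 ≤ n) (hd : DownLinked E F lev k)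
    {Y : Finset (Finset W)} (hY : Y ⊆ bd E (ball F lev (k + 1))) (hc : IsCycle E Y)
    {e : Finset W} (he : e ∈ bd E (fan F lev (k + 1) Y)) (heY : e ∉ Y) : ∀ q ∈ e, lev q = k := by
  intro q hq
  by_contra hlq
  have heE := bd_subset _ _ he
  obtain ⟨T, hT, heT⟩ := exists_mem_of_mem_bd he
  obtain ⟨hTb, e₁, he₁, u, hu, huT⟩ := mem_fan.1 hT
  obtain ⟨hTF, x, hx, hlx⟩ := mem_ball.1 hTb
  have hlu := h.lev_of_mem_bd_ball hk (hY he₁) hu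
  have hux := h.lev_le_of_mem hTF huT hx
  obtain ⟨p, hpq, rfl⟩ := h.exists_eq_pair heE hq
  have hpT : p ∈ T := heT (by simp)
  have hqT : q ∈ T := heT (by simp)
  have hq1 := h.lev_le_of_mem hTF huT hqT
  have hq2 := h.lev_le_of_mem hTF hqT hx
  have hp1 := h.lev_le_of_mem hTF huT hpT
  have hp2 := h.lev_le_of_mem hTF hpT hx
  have hlq' : lev q = k + 1 := by omega
  by_cases hlp : lev p = k + 1
  · have hZ := h.mem_bd_ball hd hpq.symm hlq' hlp hTb hqT hpT
    have hTe := h.face_eq hTF hqT hpT hx hpq.symm (by rintro rfl; omega) (by rintro rfl; omega)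
    rw [hTe] at huT
    simp only [mem_insert, mem_singleton] at huT
    rcases huT with rfl | rfl | rfl
    · exact heY (h.mem_of_isCycle hk hd hY hc he₁ hu hZ (by simp))
    · exact heY (h.mem_of_isCycle hk hd hY hc he₁ hu hZ (by simp))
    · omega
  · have hlp' : lev p = k := by omega
    by_cases hcov : ∃ e₂ ∈ Y, q ∈ e₂
    · obtain ⟨e₂, he₂, hqe₂⟩ := hcov
      have h1 := h.inner p (by omega) _ heE (by simp)
      have h2 : cofaces (fan F lev (k + 1) Y) {q, p} = cofaces F {q, p} := by
        ext T'
        simp only [mem_cofaces, mem_fan, mem_ball]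
        exact ⟨fun hT' => ⟨hT'.1.1.1, hT'.2⟩, fun hT' => ⟨⟨⟨hT'.1, p, hT'.2 (by simp), by omega⟩,
          e₂, he₂, q, hqe₂, hT'.2 (by simp)⟩, hT'.2⟩⟩
      have h3 := (mem_bd.1 he).2
      rw [h2, h1] at h3
      exact absurd h3 (by decide)
    · have hqu : u ≠ q := by rintro rfl; exact hcov ⟨e₁, he₁, hu⟩
      have hZ := h.mem_bd_ball hd hqu hlu hlq' hTb huT hqT
      exact hcov ⟨_, h.mem_of_isCycle hk hd hY hc he₁ hu hZ (by simp), by simp⟩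

/-- With no boundary on level `k`, the fan contains every triangle at some vertex `x` of level `k`.
For `k > 0` one of these reaches level `k - 1`, too far from `Y`; for `k = 0` this `x` is `v` and
the fan is the whole ball. -/
lemma eq_of_bd_fan_eq {k : ℕ} (hk : k + 1 ≤ n) {Y : Finset (Finset W)}
    (hY : Y ⊆ bd E (ball F lev (k + 1))) (hb : bd E (fan F lev (k + 1) Y) = Y) :
    Y = ∅ ∨ Y = bd E (ball F lev (k + 1)) := by
  rcases Y.eq_empty_or_nonempty with h0 | ⟨e, he⟩
  · exact Or.inl h0
  right
  obtain ⟨T, hT, heT⟩ := exists_mem_of_mem_bd (hb.symm ▸ he : e ∈ bd E (fan F lev (k + 1) Y))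
  obtain ⟨hTb, e₁, he₁, u, hu, huT⟩ := mem_fan.1 hT
  obtain ⟨hTF, x, hx, hlx⟩ := mem_ball.1 hTb
  have hlu := h.lev_of_mem_bd_ball hk (hY he₁) hu
  have hux := h.lev_le_of_mem hTF huT hx
  have hall : ∀ T' ∈ F, x ∈ T' → T' ∈ fan F lev (k + 1) Y := by
    refine fun T' hT' hx' => h.star_subset ((fan_subset _ _ _ _).trans (ball_subset _ _ _)) ?_ hT
      hx hT' hx'
    intro e₂ he₂ hxe
    have := h.lev_of_mem_bd_ball hk (hY (hb ▸ he₂)) hxe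
    omega
  rcases k with _ | j
  · have hxv := (h.lev_eq_zero x).1 (by omega)
    have : fan F lev (0 + 1) Y = ball F lev (0 + 1) := by
      refine (fan_subset _ _ _ _).antisymm fun T' hT' => ?_
      obtain ⟨hF', c, hc, hlc⟩ := mem_ball.1 hT'
      have hcv := (h.lev_eq_zero c).1 (by omega)
      exact hall T' hF' (by rw [hxv, ← hcv]; exact hc)
    rw [← this, hb]
  · obtain ⟨c, hc, hlc⟩ := h.exists_down x j (by omega)
    obtain ⟨T', hT', hs'⟩ := h.exists_face _ hc
    obtain ⟨-, e₂, he₂, u₂, hu₂, huT₂⟩ := mem_fan.1 (hall T' hT' (hs' (by simp)))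
    have h1 := h.lev_of_mem_bd_ball hk (hY he₂) hu₂
    have h2 := h.lev_le_of_mem hT' huT₂ (hs' (show c ∈ {x, c} by simp))
    omega

/-- The growth step from the ball of radius `k` to the ball of radius `k + 1`. -/
lemma isRoundBall_succ {k : ℕ} (hk : k + 1 ≤ n) (hd : DownLinked E F lev k)
    (hmin : ∀ Y ⊆ bd E (ball F lev k), IsCycle E Y → Y = ∅ ∨ Y = bd E (ball F lev k))
    (hfull : ∀ e ∈ E, (∀ w ∈ e, lev w = k) → e ∈ bd E (ball F lev k)) :
    IsRoundBall E F lev (k + 1) := by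
  set Z := bd E (ball F lev (k + 1)) with hZ
  have hcZ : IsCycle E Z := h.isCycle_bd (ball_subset _ _ _)
  have hfanF : ∀ Y, fan F lev (k + 1) Y ⊆ F := fun Y =>
    (fan_subset _ _ _ _).trans (ball_subset _ _ _)
  have hR : ∀ Y ⊆ Z, IsCycle E Y → (Y = ∅ ∨ Y = Z) ∨
      bd E (fan F lev (k + 1) Y) \ Y = bd E (ball F lev k) := by
    intro Y hY hc
    have hsub := h.subset_bd_fan hY
    have h1 : IsCycle E (bd E (fan F lev (k + 1) Y) \ Y) := by
      rw [← symmDiff_eq_sdiff hsub]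
      exact (h.isCycle_bd (hfanF Y)).symmDiff hc
    rcases hmin _ (fun e he => by
      rw [mem_sdiff] at he
      exact hfull e (bd_subset _ _ he.1) (h.lev_of_mem_bd_fan hk hd hY hc he.1 he.2)) h1 with h2 | h2
    · exact Or.inl (h.eq_of_bd_fan_eq hk hY ((sdiff_eq_empty_iff_subset.1 h2).antisymm hsub))
    · exact Or.inr h2
  refine ⟨⟨hcZ, ?_, fun Y hY hc => ?_, fun w => ?_⟩, fun w hw => ?_, fun w hw => ?_⟩
  · rw [nonempty_iff_ne_empty]
    intro h0
    have h1 := h.bd_inj _ (ball_subset _ _ _) h0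
    have hv := (h.lev_eq_zero v).2 rfl
    have h2 := h.card_star v (h.inner v (by omega))
    have h3 := h.six_le
    obtain ⟨T, hT⟩ := card_pos.1 (show 0 < #(star F v) by omega)
    rw [mem_star] at hT
    have : T ∈ ball F lev (k + 1) := mem_ball.2 ⟨hT.1, v, hT.2, by omega⟩
    rw [h1] at this
    exact absurd this (notMem_empty _)
  · have hY' : Z \ Y ⊆ Z := sdiff_subset
    have hc' : IsCycle E (Z \ Y) := by
      rw [← symmDiff_eq_sdiff hY]
      exact hcZ.symmDiff hc
    rcases hR Y hY hc with h1 | h1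
    · exact h1
    rcases hR _ hY' hc' with (h2 | h2) | h2
    · exact Or.inr (hY.antisymm (sdiff_eq_empty_iff_subset.1 h2))
    · left
      rw [eq_empty_iff_forall_notMem]
      intro e he
      have := hY he
      rw [← hZ, ← h2, mem_sdiff] at this
      exact this.2 he
    -- Here the fans of `Y` and of its complement both border the whole previous curve. An edge of
    -- that curve has only one triangle outside the smaller ball, so this triangle lies in both
    -- fans, and its apex would lie on both `Y` and the complement.
    · rcases (bd E (ball F lev k)).eq_empty_or_nonempty with h0 | ⟨e, he⟩
      · rw [h0] at h1
        exact h.eq_of_bd_fan_eq hk hY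
          ((sdiff_eq_empty_iff_subset.1 h1).antisymm (h.subset_bd_fan hY))
      · exfalso
        obtain ⟨T₀, hT₀, s₀⟩ := exists_mem_of_mem_bd he
        obtain ⟨T₁, hT₁, s₁⟩ := exists_mem_of_mem_bd (mem_sdiff.1 (h1.symm ▸ he)).1
        obtain ⟨T₂, hT₂, s₂⟩ := exists_mem_of_mem_bd (mem_sdiff.1 (h2.symm ▸ he)).1
        have heE := bd_subset _ _ he
        obtain ⟨hF₀, c, hc₀, hlc⟩ := mem_ball.1 hT₀
        have hne : ∀ Y ⊆ Z, ∀ T ∈ fan F lev (k + 1) Y, T ≠ T₀ := by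
          rintro Y hY T hT rfl
          obtain ⟨-, e₁, he₁, u, hu, huT⟩ := mem_fan.1 hT
          have hlu := h.lev_of_mem_bd_ball hk (hY he₁) hu
          have := h.lev_le_of_mem hF₀ huT hc₀
          omega
        have h12 : T₂ = T₁ := (h.eq_or_eq_of_coface heE hF₀ (hfanF _ hT₁) (hfanF _ hT₂)
          (hne Y hY T₁ hT₁).symm s₀ s₁ s₂).resolve_left (hne _ hY' T₂ hT₂)
        subst h12
        obtain ⟨-, e₁, he₁, u₁, hu₁, huT₁⟩ := mem_fan.1 hT₁
        obtain ⟨-, e₂, he₂, u₂, hu₂, huT₂⟩ := mem_fan.1 hT₂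
        have l₁ := h.lev_of_mem_bd_ball hk (hY he₁) hu₁
        have l₂ := h.lev_of_mem_bd_ball hk (hY' he₂) hu₂
        obtain ⟨a, b, hab, rfl⟩ := card_eq_two.1 (h.card_edge e heE)
        have hkn : k ≤ n := by omega
        have la := h.lev_of_mem_bd_ball hkn he (show a ∈ {a, b} by simp)
        have lb := h.lev_of_mem_bd_ball hkn he (show b ∈ {a, b} by simp)
        have hTe := h.face_eq (hfanF _ hT₁) (s₁ (by simp)) (s₁ (by simp)) huT₁ hab
          (by rintro rfl; omega) (by rintro rfl; omega)
        rw [hTe] at huT₂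
        simp only [mem_insert, mem_singleton] at huT₂
        rcases huT₂ with rfl | rfl | rfl
        · omega
        · omega
        · exact (mem_sdiff.1 he₂).2 (h.mem_of_isCycle hk hd hY hc he₁ hu₁ (hY' he₂) hu₂)
  · by_cases hw : lev w = k + 1
    · exact (h.card_star_bd_ball hk hd hw).1.le
    · have : star Z w = ∅ := by
        rw [eq_empty_iff_forall_notMem]
        intro e he
        rw [mem_star] at he
        exact hw (h.lev_of_mem_bd_ball hk he.1 he.2)
      rw [← hZ, this]
      simp
  · rw [← card_pos, (h.card_star_bd_ball hk hd hw).1]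
    norm_num
  · exact (h.card_star_bd_ball hk hd hw).2

/-- All edges between vertices of level `k` lie on the boundary of a round ball. -/
lemma mem_bd_of_isRoundBall {k : ℕ} (hk : k ≤ n) (hB : IsRoundBall E F lev k) {e : Finset W}
    (he : e ∈ E) (hl : ∀ w ∈ e, lev w = k) : e ∈ bd E (ball F lev k) := by
  by_contra hne
  obtain ⟨x, y, hxy, rfl⟩ := card_eq_two.1 (h.card_edge e he)
  obtain ⟨T, -, -, hpos, hsum⟩ := h.exists_region hk hB hxy (hl x (by simp)) (hl y (by simp))
    (Q := {{x, y}}) (singleton_subset_iff.2 he)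
    (fun e' he' w hw => by rw [mem_singleton] at he'; subst he'; exact (hl w hw).ge)
    (disjoint_singleton_right.2 hne) (fun w _ => star_singleton_pair x y w)
    (fun w hw => by
      have h1 : w ≠ x := by rintro rfl; exact hw (hl w (by simp))
      have h2 : w ≠ y := by rintro rfl; exact hw (hl w (by simp))
      rw [star_singleton_pair]; simp [h1, h2])
    (fun Y hY _ => subset_singleton_iff.1 hY)
  rw [singleton_biUnion, id, sum_pair hxy] at hsum
  -- The two endpoints contribute at most `2` each, short of the required `6`.
  have h1 := hpos x (by simp)
  have h2 := hpos y (by simp)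
  omega

/-- The path `x, w, y` cuts off a region whose three path vertices contribute at most `2` each. The
total `6` forces a single triangle at `w`, which contains both edges. -/
lemma downLinked_of_isRoundBall {k : ℕ} (hk : k ≤ n) (hB : IsRoundBall E F lev k) :
    DownLinked E F lev k := by
  intro w x y hw hx hy hxy hwx hwy
  have hxw := (h.ne_of_pair_mem hwx).symm
  have hyw := (h.ne_of_pair_mem hwy).symm
  have hne : ({w, x} : Finset W) ≠ {w, y} := fun heq => by
    have : x ∈ ({w, y} : Finset W) := heq ▸ (by simp)
    simp [hxw, hxy] at this
  set Q : Finset (Finset W) := {{w, x}, {w, y}} with hQ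
  have hstar : ∀ p, #(star Q p) = (if p = w ∨ p = x then 1 else 0) +
      (if p = w ∨ p = y then 1 else 0) := by
    intro p
    rw [star, card_filter, hQ, sum_pair hne]
    simp
  have hQw : ∀ e ∈ Q, w ∈ e := by
    intro e he
    simp only [hQ, mem_insert, mem_singleton] at he
    rcases he with rfl | rfl <;> simp
  obtain ⟨T, hT, hQT, hpos, hsum⟩ := h.exists_region hk hB hxy hx hy (Q := Q)
    (insert_subset hwx (singleton_subset_iff.2 hwy))
    (fun e he p hp => by
      simp only [hQ, mem_insert, mem_singleton] at he
      rcases he with rfl | rfl <;> simp only [mem_insert, mem_singleton] at hp <;>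
        rcases hp with rfl | rfl <;> omega)
    (by
      rw [disjoint_left]
      intro e he heQ
      have := h.lev_of_mem_bd_ball hk he (hQw e heQ)
      omega)
    (fun p hp => by
      have h1 : p ≠ w := by rintro rfl; omega
      rw [hstar]
      by_cases h2 : p = x
      · subst h2; simp [h1, hxy]
      · simp [h1, h2])
    (fun p hp => by
      have h1 : p ≠ x := by rintro rfl; exact hp hx
      have h2 : p ≠ y := by rintro rfl; exact hp hy
      rw [hstar]
      by_cases h3 : p = w <;> simp [h1, h2, h3])
    (fun Y hY hev => by
      have h1 := hev w (by omega)
      rw [show star Y w = Y from filter_true_of_mem fun e he => hQw e (hY he)] at h1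
      have h2 : #Q = 2 := card_pair hne
      have h3 := card_le_card hY
      obtain ⟨m, hm⟩ := h1
      rcases Nat.eq_zero_or_pos m with rfl | hm0
      · exact Or.inl (card_eq_zero.1 (by omega))
      · exact Or.inr (eq_of_subset_of_card_le hY (by omega)))
  have hV : Q.biUnion id = {w, x, y} := by
    ext p
    simp only [hQ, biUnion_insert, singleton_biUnion, id, mem_union, mem_insert, mem_singleton]
    tauto
  rw [hV] at hsum hpos
  rw [sum_insert (by simp [hxw.symm, hyw.symm]), sum_pair hxy] at hsum
  have h1 := hpos x (by simp)
  have h2 := hpos y (by simp)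
  have h3 : #(star T w) ≤ 1 := by omega
  obtain ⟨τ₁, m₁, s₁⟩ := exists_mem_of_mem_bd (hQT (show {w, x} ∈ Q by simp [hQ]))
  obtain ⟨τ₂, m₂, s₂⟩ := exists_mem_of_mem_bd (hQT (show {w, y} ∈ Q by simp [hQ]))
  have heq : τ₁ = τ₂ := card_le_one.1 h3 _ (mem_star.2 ⟨m₁, s₁ (by simp)⟩) _
    (mem_star.2 ⟨m₂, s₂ (by simp)⟩)
  subst heq
  rw [← h.face_eq (hT m₁) (s₁ (by simp)) (s₁ (by simp)) (s₂ (by simp)) hxw.symm hyw.symm hxy]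
  exact hT m₁

/-- The radius starts at one because the ball of radius `0` is empty and has no boundary curve; the
growth step therefore assumes only what also holds for it. -/
lemma isRoundBall (k : ℕ) (hk : k + 1 ≤ n) : IsRoundBall E F lev (k + 1) := by
  induction k with
  | zero =>
    have hb : ball F lev 0 = ∅ := by
      rw [eq_empty_iff_forall_notMem]; simp
    have hb0 : bd E (ball F lev 0) = ∅ := by
      rw [hb, eq_empty_iff_forall_notMem]
      intro e he
      obtain ⟨T, hT, -⟩ := exists_mem_of_mem_bd he
      exact absurd hT (notMem_empty _)
    refine h.isRoundBall_succ hk ?_ ?_ ?_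
    · intro w x y _ hx hy hxy
      exact absurd (((h.lev_eq_zero x).1 hx).trans ((h.lev_eq_zero y).1 hy).symm) hxy
    · intro Y hY _
      rw [hb0] at hY
      exact Or.inl (subset_empty.1 hY)
    · intro e he hl
      obtain ⟨x, y, hxy, rfl⟩ := card_eq_two.1 (h.card_edge e he)
      exact absurd (((h.lev_eq_zero x).1 (hl x (by simp))).trans
        ((h.lev_eq_zero y).1 (hl y (by simp))).symm) hxy
  | succ k ih =>
    have hB := ih (by omega)
    exact h.isRoundBall_succ hk (h.downLinked_of_isRoundBall (by omega) hB)
      hB.circuit.minimal fun e he hl => h.mem_bd_of_isRoundBall (by omega) hB he hl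

end IsLeveledDisc

end

/-! ### Counting edges and triangles level by level. -/

section

variable {W : Type*}

/-- The edges all of whose vertices have level `k`. -/
def levelEdges (E : Finset (Finset W)) (lev : W → ℕ) (k : ℕ) : Finset (Finset W) :=
  {e ∈ E | ∀ w ∈ e, lev w = k}

lemma mem_levelEdges {E : Finset (Finset W)} {lev : W → ℕ} {k : ℕ} {e : Finset W} :
    e ∈ levelEdges E lev k ↔ e ∈ E ∧ ∀ w ∈ e, lev w = k := by simp [levelEdges]

variable [DecidableEq W]

/-- The triangles whose lowest vertices have level `k`. -/
def annulus (F : Finset (Finset W)) (lev : W → ℕ) (k : ℕ) : Finset (Finset W) :=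
  ball F lev (k + 1) \ ball F lev k

/-- The vertices of level `k` of a triangle. -/
def atLevel (lev : W → ℕ) (k : ℕ) (T : Finset W) : Finset W := {w ∈ T | lev w = k}

lemma mem_annulus {F : Finset (Finset W)} {lev : W → ℕ} {k : ℕ} {T : Finset W} :
    T ∈ annulus F lev k ↔ T ∈ F ∧ (∃ u ∈ T, lev u = k) ∧ ∀ u ∈ T, k ≤ lev u := by
  simp only [annulus, mem_sdiff, mem_ball]
  constructor
  · rintro ⟨⟨hT, u, hu, hl⟩, hn⟩
    have h1 : ∀ u ∈ T, k ≤ lev u := fun x hx => by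
      by_contra hlt
      exact hn ⟨hT, x, hx, by omega⟩
    have := h1 u hu
    exact ⟨hT, ⟨u, hu, by omega⟩, h1⟩
  · rintro ⟨hT, ⟨u, hu, hl⟩, h1⟩
    refine ⟨⟨hT, u, hu, by omega⟩, fun ⟨_, x, hx, hlx⟩ => ?_⟩
    have := h1 x hx
    omega

lemma annulus_subset (F : Finset (Finset W)) (lev : W → ℕ) (k : ℕ) : annulus F lev k ⊆ F :=
  sdiff_subset.trans (ball_subset _ _ _)

lemma sum_card_star [Fintype W] (lev : W → ℕ) (S : Finset (Finset W)) (k : ℕ) :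
    ∑ w with lev w = k, #(star S w) = ∑ T ∈ S, #(atLevel lev k T) := by
  have h1 := sum_card_bipartiteAbove_eq_sum_card_bipartiteBelow
    (s := ({w | lev w = k} : Finset W)) (t := S) (fun w T => w ∈ T)
  simp only [bipartiteAbove, bipartiteBelow] at h1
  simp only [star]
  rw [h1]
  refine sum_congr rfl fun T _ => ?_
  congr 1
  ext w
  simp [atLevel, and_comm]

namespace IsTriangulatedSurface

variable {E F : Finset (Finset W)} (hs : IsTriangulatedSurface E F)

include hs

/-- A nonempty set of triangles without boundary spreads along edges to every vertex; its star at
`w₀` would make `w₀` inner. This is the vanishing of the second homology. -/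
lemma eq_empty_of_bd_eq_empty
    (hconn : ∀ a b, Relation.ReflTransGen (fun a b => a ≠ b ∧ {a, b} ∈ E) a b)
    {w₀ : W} (hw₀ : ¬ IsInner E F w₀) {S : Finset (Finset W)} (hS : S ⊆ F) (hb : bd E S = ∅) :
    S = ∅ := by
  by_contra hne
  obtain ⟨T₀, hT₀⟩ := nonempty_iff_ne_empty.2 hne
  have hbw : ∀ w, ∀ e ∈ bd E S, w ∉ e := by simp [hb]
  have h3 := hs.card_face T₀ (hS hT₀)
  obtain ⟨a, ha⟩ := card_pos.1 (show 0 < #T₀ by omega)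
  have key : ∀ b, ∃ T ∈ S, b ∈ T := by
    intro b
    induction hconn a b with
    | refl => exact ⟨T₀, hT₀, ha⟩
    | @tail c d _ hcd ih =>
      obtain ⟨T, hT, hcT⟩ := ih
      obtain ⟨T', hT', hs'⟩ := hs.exists_face _ hcd.2
      exact ⟨T', hs.star_subset hS (hbw c) hT hcT hT' (hs' (by simp)), hs' (by simp)⟩
  obtain ⟨T, hT, hw⟩ := key w₀
  exact hw₀ (hs.isInner_of_star hS (hbw w₀) hT hw)

end IsTriangulatedSurface

namespace IsLeveledDisc

variable {E F : Finset (Finset W)} {v : W} {lev : W → ℕ} {n t : ℕ}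
  (h : IsLeveledDisc E F v lev n t)

include h

lemma levelEdges_zero : levelEdges E lev 0 = ∅ := by
  rw [eq_empty_iff_forall_notMem]
  intro e he
  obtain ⟨heE, hl⟩ := mem_levelEdges.1 he
  obtain ⟨x, y, hxy, rfl⟩ := card_eq_two.1 (h.card_edge e heE)
  exact hxy (((h.lev_eq_zero x).1 (hl x (by simp))).trans
        ((h.lev_eq_zero y).1 (hl y (by simp))).symm)

lemma levelEdges_succ {k : ℕ} (hk : k + 1 ≤ n) :
    levelEdges E lev (k + 1) = bd E (ball F lev (k + 1)) := by
  ext e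
  rw [levelEdges, mem_filter]
  exact ⟨fun he => h.mem_bd_of_isRoundBall hk (h.isRoundBall k hk) he.1 he.2,
    fun he => ⟨bd_subset _ _ he, fun w hw => h.lev_of_mem_bd_ball hk he hw⟩⟩

lemma exists_lev_ne {k : ℕ} (hk : k ≤ n) {T : Finset W} (hT : T ∈ annulus F lev k) :
    ∃ w ∈ T, lev w ≠ k := by
  by_contra! hall
  have hTF := annulus_subset _ _ _ hT
  have hsub : {T} ⊆ F := singleton_subset_iff.2 hTF
  rcases k with _ | k
  · have h1 := h.card_face T hTF
    have h2 : #T ≤ 1 := card_le_one.2 fun a ha b hb =>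
      ((h.lev_eq_zero a).1 (hall a ha)).trans ((h.lev_eq_zero b).1 (hall b hb)).symm
    omega
  -- The three edges of `T` would lie on the simple closed curve and so be all of it; then `T` alone
  -- would be the ball, which it is not part of.
  · have h1 : bd E {T} ⊆ bd E (ball F lev (k + 1)) := by
      intro e he
      rw [← h.levelEdges_succ hk, levelEdges, mem_filter]
      obtain ⟨T', hT', hs⟩ := exists_mem_of_mem_bd he
      rw [mem_singleton] at hT'
      subst hT'
      exact ⟨bd_subset _ _ he, fun w hw => hall w (hs hw)⟩
    rcases (h.isRoundBall k hk).circuit.minimal _ h1 (h.isCycle_bd hsub) with h2 | h2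
    · exact singleton_ne_empty T (h.bd_inj _ hsub h2)
    · have h3 : {T} ∆ ball F lev (k + 1) = ∅ := by
        refine h.bd_inj _ (fun x hx => ?_) (by rw [bd_symmDiff, h2]; exact symmDiff_self _)
        rcases mem_symmDiff.1 hx with hx | hx
        exacts [hsub hx.1, ball_subset _ _ _ hx.1]
      have h4 : {T} = ball F lev (k + 1) := symmDiff_eq_bot.1 h3
      have h5 : T ∈ ball F lev (k + 1) := h4 ▸ mem_singleton_self T
      exact (mem_sdiff.1 hT).2 h5

lemma card_atLevel_add {k : ℕ} {T : Finset W} (hT : T ∈ annulus F lev k) :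
    #(atLevel lev k T) + #(atLevel lev (k + 1) T) = 3 := by
  obtain ⟨hTF, ⟨u, hu, hlu⟩, hge⟩ := mem_annulus.1 hT
  rw [← h.card_face T hTF, atLevel, atLevel, ← card_union_of_disjoint, ← filter_or]
  · congr 1
    refine filter_true_of_mem fun x hx => ?_
    have h1 := hge x hx
    have h2 := h.lev_le_of_mem hTF hx hu
    omega
  · rw [disjoint_filter]
    intros
    omega

/-- The three vertices split as `1 + 2` between the levels, and `m` choose `2` equals `m - 1` for `m
= 1` and `m = 2`. -/
lemma card_levelEdges_of_face {k : ℕ} (hk : k ≤ n) {T : Finset W} (hT : T ∈ annulus F lev k) :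
    #{e ∈ levelEdges E lev k | e ⊆ T} + 1 = #(atLevel lev k T) ∧
    #{e ∈ levelEdges E lev (k + 1) | e ⊆ T} + 1 = #(atLevel lev (k + 1) T) := by
  have hTF := annulus_subset _ _ _ hT
  have key : ∀ j, {e ∈ levelEdges E lev j | e ⊆ T} = (atLevel lev j T).powersetCard 2 := by
    intro j
    ext e
    simp only [levelEdges, mem_filter, mem_powersetCard]
    constructor
    · rintro ⟨⟨he, hl⟩, hs⟩
      exact ⟨fun x hx => mem_filter.2 ⟨hs hx, hl x hx⟩, h.card_edge e he⟩
    · rintro ⟨hs, hc⟩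
      have hsT : e ⊆ T := hs.trans (filter_subset _ _)
      exact ⟨⟨h.edge_mem T hTF e hsT hc, fun w hw => (mem_filter.1 (hs hw)).2⟩, hsT⟩
  rw [key, key, card_powersetCard, card_powersetCard]
  have h3 := h.card_atLevel_add hT
  obtain ⟨u, hu, hlu⟩ := (mem_annulus.1 hT).2.1
  obtain ⟨w, hw, hlw⟩ := h.exists_lev_ne hk hT
  have h1 : 0 < #(atLevel lev k T) := card_pos.2 ⟨u, mem_filter.2 ⟨hu, hlu⟩⟩
  have h2 : 0 < #(atLevel lev (k + 1) T) := by
    have := (mem_annulus.1 hT).2.2 w hw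
    have := h.lev_le_of_mem hTF hw hu
    exact card_pos.2 ⟨w, mem_filter.2 ⟨hw, by omega⟩⟩
  obtain h4 | h4 : #(atLevel lev k T) = 1 ∧ #(atLevel lev (k + 1) T) = 2 ∨
      #(atLevel lev k T) = 2 ∧ #(atLevel lev (k + 1) T) = 1 := by omega
  · rw [h4.1, h4.2]; decide
  · rw [h4.1, h4.2]; decide

lemma card_cofaces_ball_eq_one {k : ℕ} {e : Finset W} (he : e ∈ bd E (ball F lev k)) :
    #(cofaces (ball F lev k) e) = 1 := by
  obtain ⟨heE, ho⟩ := mem_bd.1 he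
  have h1 : #(cofaces (ball F lev k) e) ≤ #(cofaces F e) :=
    card_le_card (filter_subset_filter _ (ball_subset _ _ _))
  have h2 := h.card_cofaces_le e heE
  obtain ⟨m, hm⟩ := ho
  omega

/-- An edge of level `k` is not on the boundary of the surface and has one of its two triangles in
the inner ball. An edge of level `k + 1` has one triangle in the outer ball, which cannot reach
below level `k`. -/
lemma card_cofaces_annulus {k : ℕ} (hk : k + 1 ≤ n) {e : Finset W}
    (he : e ∈ levelEdges E lev k ∨ e ∈ levelEdges E lev (k + 1)) :
    #(cofaces (annulus F lev k) e) = 1 := by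
  rcases he with he | he
  · rcases k with _ | k
    · rw [h.levelEdges_zero] at he
      exact absurd he (notMem_empty _)
    have hl := (mem_levelEdges.1 he).2
    rw [h.levelEdges_succ (by omega)] at he
    have h1 := h.card_cofaces_ball_eq_one he
    have heE := bd_subset _ _ he
    obtain ⟨w, hw⟩ := card_pos.1 (show 0 < #e by rw [h.card_edge e heE]; norm_num)
    have h2 := h.inner w (by rw [hl w hw]; omega) e heE hw
    have h3 : cofaces F e = cofaces (ball F lev (k + 1)) e ∪ cofaces (annulus F lev (k + 1)) e := by
      ext T
      simp only [mem_union, mem_cofaces, annulus, mem_sdiff]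
      constructor
      · rintro ⟨hT, hs⟩
        have : T ∈ ball F lev (k + 1 + 1) := mem_ball.2 ⟨hT, w, hs hw, by rw [hl w hw]; omega⟩
        tauto
      · rintro (hT | hT)
        exacts [⟨ball_subset _ _ _ hT.1, hT.2⟩, ⟨ball_subset _ _ _ hT.1.1, hT.2⟩]
    rw [h3, card_union_of_disjoint] at h2
    · omega
    · rw [disjoint_left]
      intro T hT hT'
      exact (mem_sdiff.1 (mem_cofaces.1 hT').1).2 (mem_cofaces.1 hT).1
  · have hl := (mem_levelEdges.1 he).2
    rw [h.levelEdges_succ hk] at he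
    rw [← h.card_cofaces_ball_eq_one he]
    obtain ⟨w, hw⟩ := card_pos.1 (show 0 < #e by rw [h.card_edge e (bd_subset _ _ he)]; norm_num)
    congr 1
    ext T
    simp only [mem_cofaces, annulus, mem_sdiff]
    refine ⟨fun hT => ⟨hT.1.1, hT.2⟩, fun hT => ⟨⟨hT.1, fun hb => ?_⟩, hT.2⟩⟩
    obtain ⟨hTF, u, hu, hlu⟩ := mem_ball.1 hb
    have h1 := h.lev_le_of_mem hTF (hT.2 hw) hu
    have h2 := hl w hw
    omega

lemma sum_card_levelEdges {k j : ℕ} (hk : k + 1 ≤ n) (hj : j = k ∨ j = k + 1) :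
    ∑ T ∈ annulus F lev k, #{e ∈ levelEdges E lev j | e ⊆ T} = #(levelEdges E lev j) := by
  have h1 := sum_card_bipartiteAbove_eq_sum_card_bipartiteBelow (s := levelEdges E lev j)
    (t := annulus F lev k) (fun e T => e ⊆ T)
  simp only [bipartiteAbove, bipartiteBelow] at h1
  rw [← h1, sum_const_nat (m := 1), mul_one]
  intro e he
  exact h.card_cofaces_annulus hk (by rcases hj with rfl | rfl <;> simp [he])

lemma sum_card_atLevel {k : ℕ} (hk : k + 1 ≤ n) :
    ∑ T ∈ annulus F lev k, #(atLevel lev k T) = #(levelEdges E lev k) + #(annulus F lev k) ∧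
    ∑ T ∈ annulus F lev k, #(atLevel lev (k + 1) T) =
      #(levelEdges E lev (k + 1)) + #(annulus F lev k) := by
  rw [← h.sum_card_levelEdges hk (Or.inl rfl), ← h.sum_card_levelEdges hk (Or.inr rfl),
    card_eq_sum_ones (annulus F lev k), ← sum_add_distrib, ← sum_add_distrib]
  exact ⟨sum_congr rfl fun T hT => (h.card_levelEdges_of_face (by omega) hT).1.symm,
    sum_congr rfl fun T hT => (h.card_levelEdges_of_face (by omega) hT).2.symm⟩

lemma card_annulus {k : ℕ} (hk : k + 1 ≤ n) :
    #(annulus F lev k) = #(levelEdges E lev k) + #(levelEdges E lev (k + 1)) := by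
  obtain ⟨h1, h2⟩ := h.sum_card_atLevel hk
  have h3 : ∑ T ∈ annulus F lev k, (#(atLevel lev k T) + #(atLevel lev (k + 1) T)) =
      #(annulus F lev k) * 3 := sum_const_nat fun T hT => h.card_atLevel_add hT
  rw [sum_add_distrib] at h3
  omega

variable [Fintype W]

/-- The sphere passes through every vertex of its level with degree two. This needs no interior
vertices, so it also holds for radius `n`. -/
lemma card_level_succ {k : ℕ} (hk : k + 1 ≤ n) :
    #({w | lev w = k + 1} : Finset W) = #(levelEdges E lev (k + 1)) := by
  have hB := h.isRoundBall k hk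
  have h1 := sum_card_star lev (levelEdges E lev (k + 1)) (k + 1)
  rw [sum_const_nat (m := 2), sum_const_nat (m := 2)] at h1
  · omega
  · intro e he
    obtain ⟨heE, hl⟩ := mem_levelEdges.1 he
    rw [atLevel, filter_true_of_mem hl, h.card_edge e heE]
  · intro w hw
    have hw' : lev w = k + 1 := (mem_filter.1 hw).2
    rw [h.levelEdges_succ hk]
    have h2 := card_pos.2 (hB.nonempty w hw')
    have h3 := hB.circuit.card_star_le w
    obtain ⟨m, hm⟩ := hB.circuit.cycle.2 w
    omega

lemma mul_card_level {k : ℕ} (hk : k < n) :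
    t * #({w | lev w = k} : Finset W) = ∑ T ∈ F, #(atLevel lev k T) := by
  rw [← sum_card_star lev, sum_const_nat (m := t), mul_comm]
  intro w hw
  have hw' : lev w = k := (mem_filter.1 hw).2
  exact h.card_star w (h.inner w (by omega))

lemma card_levelEdges_one (hn : 1 ≤ n) : #(levelEdges E lev 1) = t := by
  have h1 := h.mul_card_level (k := 0) hn
  have h2 : ({w | lev w = 0} : Finset W) = {v} := by
    ext w; simp [h.lev_eq_zero]
  have h3 : ∑ T ∈ F, #(atLevel lev 0 T) = ∑ T ∈ annulus F lev 0, #(atLevel lev 0 T) := by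
    refine (sum_subset (annulus_subset _ _ _) fun T hT hn => ?_).symm
    rw [card_eq_zero, atLevel, filter_eq_empty_iff]
    exact fun w hw hl => hn (mem_annulus.2 ⟨hT, ⟨w, hw, hl⟩, fun _ _ => Nat.zero_le _⟩)
  rw [h2, h3, (h.sum_card_atLevel hn).1, h.card_annulus hn, h.levelEdges_zero] at h1
  simpa using h1.symm

lemma card_levelEdges_add_two {k : ℕ} (hk : k + 2 ≤ n) :
    #(levelEdges E lev (k + 2)) + 4 * #(levelEdges E lev (k + 1)) + #(levelEdges E lev k) =
      t * #(levelEdges E lev (k + 1)) := by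
  rw [← h.card_level_succ (k := k) (by omega), h.mul_card_level (by omega),
    h.card_level_succ (k := k) (by omega)]
  have hdisj : Disjoint (annulus F lev (k + 1)) (annulus F lev k) := by
    rw [disjoint_left]
    intro T h1 h2
    obtain ⟨u, hu, hl⟩ := (mem_annulus.1 h2).2.1
    have := (mem_annulus.1 h1).2.2 u hu
    omega
  have h3 : ∑ T ∈ F, #(atLevel lev (k + 1) T) =
      ∑ T ∈ annulus F lev (k + 1) ∪ annulus F lev k, #(atLevel lev (k + 1) T) := by
    refine (sum_subset (union_subset (annulus_subset _ _ _) (annulus_subset _ _ _))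
      fun T hT hn => ?_).symm
    rw [card_eq_zero, atLevel, filter_eq_empty_iff]
    intro w hw hl
    rw [mem_union, not_or, mem_annulus, mem_annulus] at hn
    by_cases hex : ∃ u ∈ T, lev u = k
    · refine hn.2 ⟨hT, hex, fun u hu => ?_⟩
      have := h.lev_le_of_mem hT hw hu
      omega
    · refine hn.1 ⟨hT, ⟨w, hw, hl⟩, fun u hu => ?_⟩
      have := h.lev_le_of_mem hT hw hu
      by_contra hlt
      exact hex ⟨u, hu, by omega⟩
  rw [h3, sum_union hdisj, (h.sum_card_atLevel (k := k + 1) hk).1,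
    (h.sum_card_atLevel (k := k) (by omega)).2, h.card_annulus (k := k + 1) hk,
    h.card_annulus (k := k) (by omega)]
  ring

theorem card_levelEdges (k : ℕ) (hk : k ≤ n) :
    (#(levelEdges E lev k) : ℤ) = t * lucasU ((t : ℤ) - 4) 1 k := by
  induction k using Nat.strong_induction_on with
  | _ k ih =>
    match k with
    | 0 => simp [h.levelEdges_zero, lucasU]
    | 1 => simp [h.card_levelEdges_one hk, lucasU]
    | k + 2 =>
      have h1 := ih k (by omega) (by omega)
      have h2 := ih (k + 1) (by omega) (by omega)
      have h3 := h.card_levelEdges_add_two hk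
      zify at h3
      rw [lucasU]
      linear_combination h3 - h1 + ((t : ℤ) - 4) * h2

end IsLeveledDisc

end

end FaceSet

end Combinatorics

/-! ### From triangulated discs to sets of edges and triangles. -/

section Bridge

open Finset FaceSet
open scoped Classical

namespace AbstractSimplicialComplex

variable {W : Type*}

/-- The `d`-dimensional simplices of a finite complex. -/
noncomputable def simplices [Fintype W] (D : AbstractSimplicialComplex W) (d : ℕ) :
    Finset (Finset W) := {s | s ∈ D.faces ∧ #s = d + 1}

/-- A common description of triangulated circles and arcs: the vertices are `c i` for `i ∈ P`, the
edges join `c i` and `c (σ i)` for `i ∈ Q`, and the edges are connected to each other. -/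
structure IsChart (K : PreAbstractSimplicialComplex W) {ι : Type} (P Q : Set ι) (σ : ι → ι)
    (c : ι → W) : Prop where
  faces_eq : K.faces = {s | (∃ i ∈ P, s = {c i}) ∨ ∃ i ∈ Q, s = {c i, c (σ i)}}
  injOn : Set.InjOn c P
  left_mem : ∀ i ∈ Q, i ∈ P
  right_mem : ∀ i ∈ Q, σ i ∈ P
  ne : ∀ i ∈ Q, i ≠ σ i
  injOn_succ : Set.InjOn σ Q
  exists_edge : ∀ i ∈ P, i ∈ Q ∨ ∃ j ∈ Q, σ j = i
  connected : ∀ p : ι → Prop, (∀ i ∈ Q, σ i ∈ Q → (p i ↔ p (σ i))) →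
    ∀ i ∈ Q, ∀ j ∈ Q, p i → p j

lemma exists_isChart_of_isCircle {K : PreAbstractSimplicialComplex W} (hK : K.IsCircle) :
    ∃ (ι : Type) (P Q : Set ι) (σ : ι → ι) (c : ι → W), IsChart K P Q σ c := by
  obtain ⟨k, c, hk, hc, hf⟩ := hK
  have : NeZero k := ⟨by omega⟩
  have : Fact (1 < k) := ⟨by omega⟩
  refine ⟨ZMod k, Set.univ, Set.univ, (· + 1), c, ⟨?_, hc.injOn, fun _ _ => trivial,
    fun _ _ => trivial, fun i _ => by simp, (add_left_injective 1).injOn,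
    fun _ _ => Or.inl trivial, ?_⟩⟩
  · rw [hf]
    ext s
    simp [exists_or]
  · intro p hp i _ j _ hi
    have h1 : ∀ m : ℕ, p (i + m) := by
      intro m
      induction m with
      | zero => simpa using hi
      | succ m ih =>
        have := (hp (i + m) trivial trivial).1 ih
        simpa [add_assoc] using this
    have h2 := h1 (j - i).val
    rwa [ZMod.natCast_val, ZMod.cast_id, add_sub_cancel] at h2

lemma exists_isChart_of_isArc {K : PreAbstractSimplicialComplex W} (hK : K.IsArc) :
    ∃ (ι : Type) (P Q : Set ι) (σ : ι → ι) (c : ι → W), IsChart K P Q σ c ∧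
      ∃ i ∈ P, ∀ j ∈ Q, σ j ≠ i := by
  obtain ⟨k, c, hk, hc, hf⟩ := hK
  refine ⟨ℕ, Set.Iic k, Set.Iio k, (· + 1), c, ⟨?_, hc, fun i hi => Set.mem_Iic.2 (Set.mem_Iio.1 hi).le,
    fun i hi => hi,
    fun i _ => by simp, (add_left_injective 1).injOn, fun i hi => ?_, ?_⟩, 0, Nat.zero_le _,
    fun j _ => Nat.succ_ne_zero j⟩
  · rw [hf]
    rfl
  · rcases (Set.mem_Iic.1 hi).lt_or_eq with h | h
    · exact Or.inl h
    · exact Or.inr ⟨i - 1, show i - 1 < k by omega, show i - 1 + 1 = i by omega⟩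
  · intro p hp i hi j hj hpi
    have h1 : ∀ m, m < k → (p m ↔ p 0) := by
      intro m
      induction m with
      | zero => simp
      | succ m ih =>
        intro hm
        rw [← ih (by omega)]
        exact (hp m (show m < k by omega) hm).symm
    exact (h1 j hj).2 ((h1 i hi).1 hpi)

section

variable {D : AbstractSimplicialComplex W}

lemma mem_faces_of_subset {s r : Finset W} (hs : s ∈ D.faces) (hr : r ⊆ s) (hne : r.Nonempty) :
    r ∈ D.faces := (D.isRelLowerSet_faces hs).2 hr hne

lemma IsDisc.exists_isChart (hD : D.IsDisc) (w : W) :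
    ∃ (ι : Type) (P Q : Set ι) (σ : ι → ι) (c : ι → W), IsChart (D.link w) P Q σ c := by
  rcases hD.link_circle_or_arc w with hl | hl
  · exact exists_isChart_of_isCircle hl
  · obtain ⟨ι, P, Q, σ, c, hc, -⟩ := exists_isChart_of_isArc hl
    exact ⟨ι, P, Q, σ, c, hc⟩

section Chart

variable {w : W} {ι : Type} {P Q : Set ι} {σ : ι → ι} {c : ι → W}
  (h : IsChart (D.link w) P Q σ c)

include h

lemma IsChart.mem_link_pair {i : ι} (hi : i ∈ Q) : {c i, c (σ i)} ∈ (D.link w).faces := by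
  rw [h.faces_eq]
  exact Or.inr ⟨i, hi, rfl⟩

lemma IsChart.apply_ne {i : ι} (hi : i ∈ Q) : c i ≠ c (σ i) := fun heq =>
  h.ne i hi (h.injOn (h.left_mem i hi) (h.right_mem i hi) heq)

lemma IsChart.eq_or_eq {i p : ι} (hi : i ∈ Q) (hp : p ∈ P) (hw : w ≠ c p)
    (hs : {w, c p} ⊆ ({w, c i, c (σ i)} : Finset W)) : p = i ∨ p = σ i := by
  have : c p ∈ ({w, c i, c (σ i)} : Finset W) := hs (by simp)
  simp only [mem_insert, mem_singleton] at this
  rcases this with h1 | h1 | h1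
  · exact absurd h1.symm hw
  · exact Or.inl (h.injOn hp (h.left_mem i hi) h1)
  · exact Or.inr (h.injOn hp (h.right_mem i hi) h1)

end Chart

variable [Fintype W]

lemma mem_simplices {d : ℕ} {s : Finset W} :
    s ∈ D.simplices d ↔ s ∈ D.faces ∧ #s = d + 1 := by simp [simplices]

lemma numFaces_eq (d : ℕ) : D.numFaces d = #(D.simplices d) := by
  rw [numFaces, ← Set.ncard_coe_finset]
  congr 1
  ext s
  simp [simplices]

section Chart

variable {w : W} {ι : Type} {P Q : Set ι} {σ : ι → ι} {c : ι → W}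
  (h : IsChart (D.link w) P Q σ c)

include h

lemma IsChart.mem_triangles {T : Finset W} :
    T ∈ D.simplices 2 ∧ w ∈ T ↔ ∃ i ∈ Q, T = {w, c i, c (σ i)} := by
  rw [mem_simplices]
  constructor
  · rintro ⟨⟨hT, hcard⟩, hw⟩
    have hce : #(T.erase w) = 2 := by rw [card_erase_of_mem hw, hcard]
    have hl : T.erase w ∈ (D.link w).faces :=
      ⟨card_pos.1 (by omega), notMem_erase _ _, by rwa [insert_erase hw]⟩
    rw [h.faces_eq] at hl
    rcases hl with ⟨i, -, hi⟩ | ⟨i, hi, hi'⟩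
    · rw [hi, card_singleton] at hce
      omega
    · exact ⟨i, hi, by rw [← hi', insert_erase hw]⟩
  · rintro ⟨i, hi, rfl⟩
    obtain ⟨-, hw, hf⟩ := h.mem_link_pair hi
    exact ⟨⟨hf, by rw [card_insert_of_notMem hw, card_pair (h.apply_ne hi)]⟩, by simp⟩

lemma IsChart.mem_edges {u : W} (he : {w, u} ∈ D.simplices 1) : ∃ i ∈ P, u = c i := by
  rw [mem_simplices] at he
  have huw : u ≠ w := by rintro rfl; simp at he
  have hl : {u} ∈ (D.link w).faces := ⟨by simp, by simpa using huw.symm, he.1⟩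
  rw [h.faces_eq] at hl
  rcases hl with ⟨i, hi, hi'⟩ | ⟨i, hi, hi'⟩
  · exact ⟨i, hi, singleton_injective hi'⟩
  · have := congrArg card hi'
    rw [card_singleton, card_pair (h.apply_ne hi)] at this
    omega

lemma IsChart.exists_eq_edge {e : Finset W} (he : e ∈ D.simplices 1) (hw : w ∈ e) :
    ∃ p ∈ P, w ≠ c p ∧ e = {w, c p} := by
  obtain ⟨a, b, hab, rfl⟩ := card_eq_two.1 (mem_simplices.1 he).2
  simp only [mem_insert, mem_singleton] at hw
  rcases hw with rfl | rfl
  · obtain ⟨p, hp, rfl⟩ := h.mem_edges he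
    exact ⟨p, hp, hab, rfl⟩
  · rw [pair_comm] at he
    obtain ⟨p, hp, rfl⟩ := h.mem_edges he
    exact ⟨p, hp, hab.symm, pair_comm _ _⟩

lemma IsChart.exists_coface {e : Finset W} (he : e ∈ D.simplices 1) (hw : w ∈ e) :
    ∃ T ∈ D.simplices 2, e ⊆ T := by
  obtain ⟨p, hp, -, rfl⟩ := h.exists_eq_edge he hw
  rcases h.exists_edge p hp with hQ | ⟨j, hQ, rfl⟩
  · exact ⟨_, (h.mem_triangles.2 ⟨p, hQ, rfl⟩).1, by simp [insert_subset_iff]⟩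
  · exact ⟨_, (h.mem_triangles.2 ⟨j, hQ, rfl⟩).1, by simp [insert_subset_iff]⟩

/-- A triangle on the spoke to `c p` comes from the link edge leaving `p` or from one arriving at
`p`. -/
lemma IsChart.cofaces_subset {p : ι} (hp : p ∈ P) (hw : w ≠ c p) :
    (∀ T ∈ cofaces (D.simplices 2) {w, c p}, T = {w, c p, c (σ p)} ∨
      ∃ j ∈ Q, σ j = p ∧ T = {w, c j, c (σ j)}) := by
  intro T hT
  rw [mem_cofaces] at hT
  obtain ⟨i, hi, rfl⟩ := h.mem_triangles.1 ⟨hT.1, hT.2 (mem_insert_self _ _)⟩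
  rcases h.eq_or_eq hi hp hw hT.2 with rfl | rfl
  · exact Or.inl rfl
  · exact Or.inr ⟨i, hi, rfl, rfl⟩

lemma IsChart.card_cofaces_le_two {e : Finset W} (he : e ∈ D.simplices 1) (hw : w ∈ e) :
    #(cofaces (D.simplices 2) e) ≤ 2 := by
  obtain ⟨p, hp, hwp, rfl⟩ := h.exists_eq_edge he hw
  have hsub := h.cofaces_subset hp hwp
  by_cases hj : ∃ j ∈ Q, σ j = p
  · obtain ⟨j, hj, hjp⟩ := hj
    refine (card_le_card (t := {{w, c p, c (σ p)}, {w, c j, c (σ j)}}) fun T hT => ?_).trans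
      card_le_two
    rw [mem_insert, mem_singleton]
    rcases hsub T hT with h1 | ⟨j', hj', hjp', rfl⟩
    · exact Or.inl h1
    · rw [h.injOn_succ hj' hj (hjp'.trans hjp.symm)]
      exact Or.inr rfl
  · refine (card_le_card (t := {{w, c p, c (σ p)}}) fun T hT => ?_).trans (by simp)
    rw [mem_singleton]
    exact (hsub T hT).resolve_right fun ⟨j, hj', hjp, _⟩ => hj ⟨j, hj', hjp⟩

lemma IsChart.card_cofaces_le_one {p : ι} (hp : p ∈ P) (hw : w ≠ c p) (hj : ∀ j ∈ Q, σ j ≠ p) :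
    #(cofaces (D.simplices 2) {w, c p}) ≤ 1 := by
  refine (card_le_card (t := {{w, c p, c (σ p)}}) fun T hT => ?_).trans (by simp)
  rw [mem_singleton]
  exact (h.cofaces_subset hp hw T hT).resolve_right fun ⟨j, hj', hjp, _⟩ => hj j hj' hjp

lemma IsChart.star_connected {S : Finset (Finset W)} (hS : S ⊆ D.simplices 2)
    (hcl : ∀ e ∈ D.simplices 1, w ∈ e → ∀ T ∈ S, ∀ T' ∈ D.simplices 2, e ⊆ T → e ⊆ T' → T' ∈ S)
    {T T' : Finset W} (hT : T ∈ S) (hw : w ∈ T) (hT' : T' ∈ D.simplices 2) (hw' : w ∈ T') :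
    T' ∈ S := by
  obtain ⟨i, hi, rfl⟩ := h.mem_triangles.1 ⟨hS hT, hw⟩
  obtain ⟨j, hj, rfl⟩ := h.mem_triangles.1 ⟨hT', hw'⟩
  refine h.connected (fun i => {w, c i, c (σ i)} ∈ S) ?_ i hi j hj hT
  intro m hm hm'
  have h1 := (h.mem_triangles.2 ⟨m, hm, rfl⟩).1
  have h2 := (h.mem_triangles.2 ⟨σ m, hm', rfl⟩).1
  have s1 : {w, c (σ m)} ⊆ ({w, c m, c (σ m)} : Finset W) := by simp [insert_subset_iff]
  have s2 : {w, c (σ m)} ⊆ ({w, c (σ m), c (σ (σ m))} : Finset W) := by simp [insert_subset_iff]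
  have he : {w, c (σ m)} ∈ D.simplices 1 := by
    rw [mem_simplices]
    refine ⟨mem_faces_of_subset (mem_simplices.1 h1).1 s1 (by simp), card_pair ?_⟩
    rintro heq
    exact (h.mem_link_pair hm).2.1 (heq ▸ by simp)
  exact ⟨fun hm => hcl _ he (by simp) _ hm _ h2 s1 s2,
    fun hm => hcl _ he (by simp) _ hm _ h1 s2 s1⟩

end Chart

lemma IsDisc.isTriangulatedSurface (hD : D.IsDisc) :
    IsTriangulatedSurface (D.simplices 1) (D.simplices 2) where
  card_edge e he := (mem_simplices.1 he).2
  card_face T hT := (mem_simplices.1 hT).2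
  edge_mem T hT e he hc := mem_simplices.2
    ⟨mem_faces_of_subset (mem_simplices.1 hT).1 he (card_pos.1 (by omega)), hc⟩
  exists_face e he := by
    obtain ⟨w, hw⟩ := card_pos.1 (show 0 < #e by rw [(mem_simplices.1 he).2]; omega)
    obtain ⟨ι, P, Q, σ, c, hc⟩ := hD.exists_isChart w
    exact hc.exists_coface he hw
  card_cofaces_le e he := by
    obtain ⟨w, hw⟩ := card_pos.1 (show 0 < #e by rw [(mem_simplices.1 he).2]; omega)
    obtain ⟨ι, P, Q, σ, c, hc⟩ := hD.exists_isChart w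
    exact hc.card_cofaces_le_two he hw
  star_connected w S hS hcl T hT hw T' hT' hw' := by
    obtain ⟨ι, P, Q, σ, c, hc⟩ := hD.exists_isChart w
    exact hc.star_connected hS hcl hT hw hT' hw'

/-- The first vertex of an arc link has no predecessor, so the spoke to it lies in at most one
triangle. -/
lemma IsDisc.exists_not_isInner (hD : D.IsDisc) :
    ∃ w, ¬ IsInner (D.simplices 1) (D.simplices 2) w := by
  obtain ⟨w, hw⟩ := hD.exists_link_arc
  obtain ⟨ι, P, Q, σ, c, hc, p, hp, hj⟩ := exists_isChart_of_isArc hw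
  refine ⟨w, fun hin => ?_⟩
  have hl : {c p} ∈ (D.link w).faces := by
    rw [hc.faces_eq]
    exact Or.inl ⟨p, hp, rfl⟩
  obtain ⟨-, hwp, hf⟩ := hl
  rw [mem_singleton] at hwp
  have h1 := hc.card_cofaces_le_one hp hwp hj
  have h2 := hin {w, c p} (mem_simplices.2 ⟨hf, card_pair hwp⟩) (by simp)
  omega

lemma IsDisc.isInner_iff (hD : D.IsDisc) {w : W} :
    IsInner (D.simplices 1) (D.simplices 2) w ↔ D.IsInterior w := by
  have hs := hD.isTriangulatedSurface
  have key : ∀ e ∈ D.simplices 1, #(cofaces (D.simplices 2) e) = 1 ↔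
      ∃! T : Finset W, T ∈ D.faces ∧ #T = 3 ∧ e ⊆ T := by
    intro e _
    rw [card_eq_one_iff_existsUnique]
    simp only [mem_cofaces, mem_simplices, and_assoc]
  constructor
  · rintro hin ⟨-, e, he, hc, hwe, hT⟩
    have he' : e ∈ D.simplices 1 := mem_simplices.2 ⟨he, hc⟩
    have h1 := hin e he' (singleton_subset_iff.1 hwe)
    rw [(key e he').2 hT] at h1
    omega
  · intro hin e he hwe
    have h1 := hs.card_cofaces_le e he
    have h2 : #(cofaces (D.simplices 2) e) ≠ 1 := fun h1 =>
      hin ⟨by simp, e, (mem_simplices.1 he).1, (mem_simplices.1 he).2,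
        singleton_subset_iff.2 hwe, (key e he).1 h1⟩
    obtain ⟨T, hT, heT⟩ := hs.exists_face e he
    have h3 : 0 < #(cofaces (D.simplices 2) e) := card_pos.2 ⟨T, mem_cofaces.2 ⟨hT, heT⟩⟩
    omega

lemma ncard_link_vertices (w : W) :
    {u | ({u} : Finset W) ∈ (D.link w).faces}.ncard = #(star (D.simplices 1) w) := by
  rw [← Set.ncard_coe_finset]
  have hmem : ∀ u, ({u} : Finset W) ∈ (D.link w).faces ↔ u ≠ w ∧ {w, u} ∈ D.faces := by
    intro u
    have : w ∉ ({u} : Finset W) ↔ u ≠ w := by rw [mem_singleton, ne_comm]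
    constructor
    · rintro ⟨-, h1, h2⟩
      exact ⟨this.1 h1, h2⟩
    · rintro ⟨h1, h2⟩
      exact ⟨by simp, this.2 h1, h2⟩
  refine Set.ncard_congr (fun u _ => {w, u}) (fun u hu => ?_) (fun a b ha hb hab => ?_)
    (fun e he => ?_)
  · obtain ⟨h1, h2⟩ := (hmem u).1 hu
    rw [mem_coe, mem_star, mem_simplices]
    exact ⟨⟨h2, card_pair h1.symm⟩, by simp⟩
  · have : a ∈ ({w, b} : Finset W) := hab ▸ (by simp)
    simpa [((hmem a).1 ha).1] using this
  · rw [mem_coe, mem_star, mem_simplices] at he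
    obtain ⟨⟨hf, hc⟩, hw⟩ := he
    obtain ⟨u, hu⟩ := card_eq_one.1 (show #(e.erase w) = 1 by rw [card_erase_of_mem hw, hc])
    have heq : e = {w, u} := by rw [← hu, insert_erase hw]
    have huw : u ≠ w := fun h' => by
      have : u ∈ e.erase w := hu ▸ mem_singleton_self u
      exact (mem_erase.1 this).1 h'
    exact ⟨u, (hmem u).2 ⟨huw, heq ▸ hf⟩, heq.symm⟩

lemma skeleton_adj_iff {a b : W} : D.skeleton.Adj a b ↔ a ≠ b ∧ {a, b} ∈ D.simplices 1 := by
  rw [mem_simplices]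
  constructor
  · rintro ⟨h1, h2⟩
    exact ⟨h1, h2, card_pair h1⟩
  · rintro ⟨h1, h2, -⟩
    exact ⟨h1, h2⟩

lemma IsDisc.isLeveledDisc (hD : D.IsDisc) {t n : ℕ} (ht : 6 ≤ t) (v : W)
    (hdeg : ∀ w, D.IsInterior w → {u | ({u} : Finset W) ∈ (D.link w).faces}.ncard = t)
    (hn : ∀ w, D.skeleton.dist v w < n → D.IsInterior w) :
    IsLeveledDisc (D.simplices 1) (D.simplices 2) v (D.skeleton.dist v) n t := by
  have hs := hD.isTriangulatedSurface
  have hconn : ∀ a b, Relation.ReflTransGen (fun a b => a ≠ b ∧ {a, b} ∈ D.simplices 1) a b := by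
    intro a b
    have := (SimpleGraph.reachable_iff_reflTransGen a b).1 (hD.connected.preconnected a b)
    exact Relation.ReflTransGen.mono (fun _ _ => skeleton_adj_iff.1) a b this
  obtain ⟨w₀, hw₀⟩ := hD.exists_not_isInner
  have hinj : ∀ S ⊆ D.simplices 2, bd (D.simplices 1) S = ∅ → S = ∅ :=
    fun S hS hb => hs.eq_empty_of_bd_eq_empty hconn hw₀ hS hb
  have h0 : D.numFaces 0 = Fintype.card W := by
    rw [numFaces_eq, ← card_univ,
      ← card_image_of_injective (univ : Finset W) (singleton_injective (α := W))]
    refine congrArg card ?_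
    ext s
    simp only [mem_simplices, zero_add, card_eq_one, mem_image, mem_univ, true_and]
    constructor
    · rintro ⟨-, a, rfl⟩
      exact ⟨a, rfl⟩
    · rintro ⟨a, rfl⟩
      exact ⟨D.singleton_mem a, a, rfl⟩
  have heuler : #(D.simplices 2) + Fintype.card W = #(D.simplices 1) + 1 := by
    have := hD.euler_char
    rw [h0, numFaces_eq, numFaces_eq] at this
    omega
  exact
    { hs with
      exists_bd := fun Y hY => exists_bd_eq_of_euler v (hconn v)
        (fun S hS => hs.isCycle_bd hS) hinj heuler hY
      bd_inj := hinj
      six_le := ht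
      card_star := fun w hw => by
        rw [hs.card_star_of_isInner hw, ← ncard_link_vertices, hdeg w (hD.isInner_iff.1 hw)]
      lev_eq_zero := fun w => by rw [hD.connected.dist_eq_zero_iff, eq_comm]
      lev_le := fun a b hab => by
        have h1 := skeleton_adj_iff.2 ⟨hs.ne_of_pair_mem hab, hab⟩
        rcases h1.diff_dist_adj (u := v) with h2 | h2 | h2 <;> omega
      exists_down := fun w k hw => by
        -- The lower neighbour is the second vertex of a geodesic from `w` to `v`.
        obtain ⟨p, hp⟩ := hD.connected.exists_walk_length_eq_dist w v
        rw [SimpleGraph.dist_comm, hw] at hp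
        cases p with
        | nil => simp at hp
        | @cons _ u _ hadj q =>
          refine ⟨u, (skeleton_adj_iff.1 hadj).2, ?_⟩
          rw [SimpleGraph.Walk.length_cons] at hp
          have h1 := SimpleGraph.dist_le q
          have h2 := hadj.diff_dist_adj (u := v)
          rw [SimpleGraph.dist_comm] at h1
          omega
      inner := fun w hw => hD.isInner_iff.2 (hn w hw) }

lemma sphere_eq (v : W) (n : ℕ) :
    D.sphere v n = (levelEdges (D.simplices 1) (D.skeleton.dist v) n : Set (Finset W)) := by
  ext e
  rw [mem_coe, mem_levelEdges, mem_simplices]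
  exact ⟨fun h => ⟨⟨h.1, h.2.1⟩, h.2.2⟩, fun h => ⟨h.1.1, h.1.2, h.2⟩⟩

end

end AbstractSimplicialComplex

end Bridge

theorem theorem3p1 {V : Type*} (t : ℕ) (ht : 6 ≤ t) (X : AbstractSimplicialComplex V)
    (hX : X.IsUniform t) (γ : PreAbstractSimplicialComplex V) (hγ : X.IsLoop γ)
    {W : Type} (D : AbstractSimplicialComplex W) (f : W → V)
    (hD : X.IsMinimalFillingDiagram γ D f) (v : W) (hv : D.IsInterior v)
    (n : ℕ) (hn : ∀ w : W, D.skeleton.dist v w < n → D.IsInterior w) :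
    ((D.sphere v n).ncard : ℤ) = t * lucasU ((t : ℤ) - 4) 1 n := by
  have hdisc := hD.1.disc
  have := hdisc.finite
  have := Fintype.ofFinite W
  classical
  rw [AbstractSimplicialComplex.sphere_eq, Set.ncard_coe_finset]
  exact (hdisc.isLeveledDisc ht v (fun w hw => hX.card_link γ hγ W D f hD w hw) hn).card_levelEdges
    n le_rfl
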